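/- Let $n$ be a dimension and let $\sigma:\mathbb R^n\to\mathbb R$ be convex, positively one-homogeneous ($\sigma(tp)=t\sigma(p)$ for $t>0$), and positive away from $0$; let $\partial\sigma(p)=\{\zeta\in\mathbb R^n : \sigma(q)\ge\sigma(p)+\zeta\cdot(q-p)\ \text{for all } q\in\mathbb R^n\}$ be its subdifferential. For an open set $U\subset\mathbb R^n$ and a Lipschitz function $\psi\in \mathrm{Lip}(U)$, define the set of Cahn–Hoffman vector fields $$CH(\psi;U):=\{z\in L^\infty(U;\mathbb R^n) : \operatorname{div} z\in L^2(U),\ z\in\partial\sigma(\nabla\psi)\ \text{a.e. in } U\},$$ where $\operatorname{div}$ is the distributional divergence. If $CH(\psi;U)\neq\emptyset$ and $f\in L^2(U)$, the $\sigma^\circ$-$(L^2)$ divergence of $\psi$ is $$\Lambda_f[\psi]:=\operatorname{div} z_{\min}-f\qquad\text{on } \{\psi=0\},$$ where $z_{\min}$ is a minimizer of $\|\operatorname{div} z-f\|_{L^2(U)}$ over $z\in CH(\psi;U)$. Write $\operatorname{sign}s=-1,0,1$ if $s<0$, $s=0$, $s>0$ respectively. **Proposition.** Let $U\subset\mathbb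 R^n$ be open, and let $\psi_1,\psi_2\in \mathrm{Lip}(U)$ be such that the sets $\{\psi_i=0\}$ are compact subsets of $U$. Let $f_1,f_2\in L^2(U)$. Suppose that $CH(\psi_i;U)\ne\emptyset$ for $i=1,2$ and that $$\operatorname{sign}\psi_1\le\operatorname{sign}\psi_2\ \text{in } U,\qquad f_1\ge f_2\ \text{a.e. in } U.$$ Then minimizers $z_{\min}$ exist for both pairs $(\psi_i,f_i)$, and for any choice of them $$\Lambda_{f_1}[\psi_1]\le\Lambda_{f_2}[\psi_2]\qquad\text{a.e. on } \{\psi_1=0\}\cap\{\psi_2=0\}.$$ -/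

import Mathlib

open MeasureTheory
open scoped ENNReal ContDiff

namespace CrystallineCurvature

/-- The convex subdifferential `∂σ(p)`. -/
def subdifferential {n : ℕ} (σ : EuclideanSpace ℝ (Fin n) → ℝ) (p : EuclideanSpace ℝ (Fin n)) :
    Set (EuclideanSpace ℝ (Fin n)) :=
  {z | ∀ q, σ p + inner ℝ z (q - p) ≤ σ q}

/-- `g` is the distributional divergence of the vector field `z` on the open set `U`:
`∫_U z · ∇φ = - ∫_U g φ` for all smooth `φ` with compact support in `U`. -/
def HasWeakDivergence {n : ℕ} (U : Set (EuclideanSpace ℝ (Fin n)))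
    (z : EuclideanSpace ℝ (Fin n) → EuclideanSpace ℝ (Fin n))
    (g : EuclideanSpace ℝ (Fin n) → ℝ) : Prop :=
  ∀ φ : EuclideanSpace ℝ (Fin n) → ℝ, ContDiff ℝ ∞ φ → HasCompactSupport φ → tsupport φ ⊆ U →
    ∫ x in U, inner ℝ (z x) (gradient φ x) = - ∫ x in U, g x * φ x

/-- `z ∈ L^∞(U)` with distributional divergence `div z = g ∈ L²(U)`. -/
structure HasL2Divergence {n : ℕ} (U : Set (EuclideanSpace ℝ (Fin n)))
    (z : EuclideanSpace ℝ (Fin n) → EuclideanSpace ℝ (Fin n))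
    (g : EuclideanSpace ℝ (Fin n) → ℝ) : Prop where
  field_memLp : MemLp z ∞ (volume.restrict U)
  div_memLp : MemLp g 2 (volume.restrict U)
  div_eq : HasWeakDivergence U z g

/-- The space `X²(U) = {z ∈ L^∞(U) | div z ∈ L²(U)}`. -/
def X2 {n : ℕ} (U : Set (EuclideanSpace ℝ (Fin n))) :
    Set (EuclideanSpace ℝ (Fin n) → EuclideanSpace ℝ (Fin n)) :=
  {z | ∃ g, HasL2Divergence U z g}

/-- Cahn–Hoffman vector fields `CH(ψ; U) = {z ∈ X²(U) | z ∈ ∂σ(∇ψ) a.e. in U}`.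
For `ψ` Lipschitz on the open set `U`, the pointwise gradient exists a.e. in `U`. -/
def CahnHoffman {n : ℕ} (σ : EuclideanSpace ℝ (Fin n) → ℝ) (ψ : EuclideanSpace ℝ (Fin n) → ℝ)
    (U : Set (EuclideanSpace ℝ (Fin n))) :
    Set (EuclideanSpace ℝ (Fin n) → EuclideanSpace ℝ (Fin n)) :=
  {z | z ∈ X2 U ∧ ∀ᵐ x ∂(volume.restrict U), z x ∈ subdifferential σ (gradient ψ x)}

/-- The zero set `{ψ = 0}` of a function on `U`. -/
def zeroSet {n : ℕ} (U : Set (EuclideanSpace ℝ (Fin n))) (ψ : EuclideanSpace ℝ (Fin n) → ℝ) :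
    Set (EuclideanSpace ℝ (Fin n)) :=
  {x | x ∈ U ∧ ψ x = 0}

/-- `z` minimizes `‖div z - f‖_{L²(U)}` over `CH(ψ; U)`, and `g = div z`. -/
def IsMinimizer {n : ℕ} (σ : EuclideanSpace ℝ (Fin n) → ℝ) (U : Set (EuclideanSpace ℝ (Fin n)))
    (ψ f : EuclideanSpace ℝ (Fin n) → ℝ)
    (z : EuclideanSpace ℝ (Fin n) → EuclideanSpace ℝ (Fin n))
    (g : EuclideanSpace ℝ (Fin n) → ℝ) : Prop :=
  z ∈ CahnHoffman σ ψ U ∧ HasL2Divergence U z g ∧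
    ∀ z' ∈ CahnHoffman σ ψ U, ∀ g', HasL2Divergence U z' g' →
      eLpNorm (g - f) 2 (volume.restrict U) ≤ eLpNorm (g' - f) 2 (volume.restrict U)

/-- `Λ` is (a representative of) the `σ°`-(`L²`) divergence `Λ_f[ψ]`, that is,
`Λ = div z_min - f` a.e. on `{ψ = 0}` for a minimizer `z_min` of `‖div z - f‖_{L²(U)}`
over `CH(ψ; U)`. -/
def IsLambda {n : ℕ} (σ : EuclideanSpace ℝ (Fin n) → ℝ) (U : Set (EuclideanSpace ℝ (Fin n)))
    (f ψ : EuclideanSpace ℝ (Fin n) → ℝ) (Λ : EuclideanSpace ℝ (Fin n) → ℝ) : Prop :=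
  ∃ z g, IsMinimizer σ U ψ f z g ∧
    ∀ᵐ x ∂(volume.restrict (zeroSet U ψ)), Λ x = g x - f x

end CrystallineCurvature

/-! Write `E_ψ(w) = ∫_U σ'(∇ψ; ∇w)` with the one-sided derivative of `σ`. Since `z ∈ ∂σ(p)` means `z
· q ≤ σ'(p; q)` for all `q`, the divergence `g` of a Cahn–Hoffman field satisfies `-∫ g w ≤ E_ψ(w)`
for every test function `w`; by Hahn–Banach this inequality also characterizes such divergences
(`exists_cahnHoffman_of_le_energy`). Minimizing `‖g - f‖` is therefore a projection, whose dual
problem is to minimize `E_ψ(w) + ‖w‖²/2 + ∫ f w`. Minimizing sequences of the dual converge in `L²`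
to `Λ = g - f`, and along them `-∫ g w ≤ E_ψ(w)` is almost an equality (`exists_isMinimizer`).

For the comparison let `D` be the common zero set. Because `σ'(p; q)` is unchanged when `p` is
multiplied by a positive number, `ψ₁, ψ₂` may be replaced by functions `φ₁, φ₂` of them; the sign
condition allows `φ₁ = φ₂` on `D` and `φ₁ < φ₂` elsewhere near `D` (`exists_relevellings`). Take
almost tight `w₁, w₂` and large `M`. Near `D`, replacing `φ₁ + w₁/M` and `φ₂ + w₂/M` by their
minimum and maximum only exchanges gradients, so the total of the `σ`-integrals is preserved. This
changes `w₁, w₂` into `w₁ - T, w₂ + T` with `T = (w₁ - w₂ - M(φ₂ - φ₁))⁺`. Testing the duality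
inequality with the new pair and using almost tightness of the old one yields, as `M → ∞`, `∫_D (w₁
- w₂)⁺ (g₁ - g₂) ≤ 2ε` (`setIntegral_posPart_mul_le`).

Since `f₁ ≥ f₂`, the same bound holds with `Λ₁ - Λ₂` in place of `g₁ - g₂`. Letting `w_i → Λ_i`
gives `∫_D ((Λ₁ - Λ₂)⁺)² ≤ 0`. -/

namespace CrystallineCurvature

open Filter Topology Set

/-! ### Sublinear functions, directional derivatives and subdifferentials. -/

section Sublinear

variable {V : Type*} [NormedAddCommGroup V] [InnerProductSpace ℝ V]

/-- A sublinear function with a linear upper bound. -/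
structure IsBoundedSublinear (σ : V → ℝ) (C : ℝ) : Prop where
  hom : ∀ t : ℝ, 0 ≤ t → ∀ p, σ (t • p) = t * σ p
  add_le : ∀ p q, σ (p + q) ≤ σ p + σ q
  le_norm : ∀ p, σ p ≤ C * ‖p‖
  nonneg : 0 ≤ C

theorem exists_isBoundedSublinear [FiniteDimensional ℝ V] {σ : V → ℝ}
    (hc : ConvexOn ℝ univ σ) (hh : ∀ t : ℝ, 0 < t → ∀ p, σ (t • p) = t * σ p) :
    ∃ C, IsBoundedSublinear σ C := by
  have h0 : σ 0 = 0 := by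
    have := hh 2 (by norm_num) 0
    rw [smul_zero] at this; linarith
  have hcont : Continuous σ := hc.locallyLipschitz.continuous
  obtain ⟨C, hC⟩ := (isCompact_sphere (0 : V) 1).bddAbove_image hcont.continuousOn
  refine ⟨max C 0, ?_, ?_, ?_, le_max_right _ _⟩
  · intro t ht p
    rcases ht.eq_or_lt with rfl | ht
    · simp [h0]
    · exact hh t ht p
  · intro p q
    -- Convexity at the midpoint of `2p` and `2q`; homogeneity then cancels the factor `2`.
    have := hc.2 (mem_univ ((2 : ℝ) • p)) (mem_univ ((2 : ℝ) • q))
      (show (0 : ℝ) ≤ 1 / 2 by norm_num) (show (0 : ℝ) ≤ 1 / 2 by norm_num) (by norm_num)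
    rw [hh 2 (by norm_num), hh 2 (by norm_num), smul_smul, smul_smul] at this
    norm_num at this
    linarith
  · intro p
    rcases eq_or_ne p 0 with rfl | hp
    · simp [h0]
    · have hn : 0 < ‖p‖ := norm_pos_iff.2 hp
      have h1 : σ (‖p‖⁻¹ • p) ≤ C := hC ⟨_, by simp [norm_smul, hn.ne'], rfl⟩
      rw [hh _ (inv_pos.2 hn)] at h1
      have h2 : σ p ≤ C * ‖p‖ := by
        rw [inv_mul_le_iff₀ hn] at h1; linarith
      exact h2.trans (by gcongr; exact le_max_left _ _)

/-- The difference quotient of `σ` at `p` in direction `q`. -/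
noncomputable def diffQuot (σ : V → ℝ) (p q : V) (a : ℝ) : ℝ := (σ (p + a • q) - σ p) / a

/-- The one-sided directional derivative of a convex function. -/
noncomputable def dirDeriv (σ : V → ℝ) (p q : V) : ℝ := ⨅ a : Ioi (0 : ℝ), diffQuot σ p q a

namespace IsBoundedSublinear

variable {σ : V → ℝ} {C : ℝ} (h : IsBoundedSublinear σ C)
include h

theorem sub_le (p q : V) : σ p - σ q ≤ C * ‖p - q‖ := by
  have := h.add_le q (p - q)
  rw [add_sub_cancel] at this
  linarith [h.le_norm (p - q)]

theorem lipschitz : LipschitzWith (Real.toNNReal C) σ := by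
  refine LipschitzWith.of_dist_le_mul fun p q => ?_
  rw [Real.coe_toNNReal _ h.nonneg, Real.dist_eq, dist_eq_norm]
  refine abs_le.2 ⟨?_, h.sub_le p q⟩
  have := h.sub_le q p
  rw [norm_sub_rev] at this; linarith

theorem continuous : Continuous σ := h.lipschitz.continuous

theorem diffQuot_mono (p q : V) {a b : ℝ} (ha : 0 < a) (hab : a ≤ b) :
    diffQuot σ p q a ≤ diffQuot σ p q b := by
  have hb : 0 < b := ha.trans_le hab
  have h1 : p + a • q = (1 - a / b) • p + (a / b) • (p + b • q) := by
    rw [smul_add, smul_smul, div_mul_cancel₀ _ hb.ne', sub_smul, one_smul]; abel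
  have h2 := h.add_le ((1 - a / b) • p) ((a / b) • (p + b • q))
  rw [← h1, h.hom _ (by rw [sub_nonneg, div_le_one hb]; exact hab), h.hom _ (by positivity)] at h2
  unfold diffQuot
  rw [div_le_iff₀ ha]
  calc σ (p + a • q) - σ p ≤ (1 - a / b) * σ p + a / b * σ (p + b • q) - σ p := by linarith
    _ = _ := by field_simp; ring

theorem neg_le_diffQuot (p q : V) {a : ℝ} (ha : 0 < a) : -(C * ‖q‖) ≤ diffQuot σ p q a := by
  unfold diffQuot
  rw [le_div_iff₀ ha]
  have := h.sub_le p (p + a • q)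
  rw [sub_add_cancel_left, norm_neg, norm_smul, Real.norm_of_nonneg ha.le] at this
  linarith

theorem diffQuot_le (p q : V) {a : ℝ} (ha : 0 < a) : diffQuot σ p q a ≤ σ q := by
  unfold diffQuot
  rw [div_le_iff₀ ha]
  have := h.add_le p (a • q)
  rw [h.hom a ha.le] at this
  linarith

theorem abs_diffQuot_le (p q : V) {a : ℝ} (ha : 0 < a) : |diffQuot σ p q a| ≤ C * ‖q‖ :=
  abs_le.2 ⟨h.neg_le_diffQuot p q ha, (h.diffQuot_le p q ha).trans (h.le_norm q)⟩

theorem dirDeriv_le_diffQuot (p q : V) {a : ℝ} (ha : 0 < a) :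
    dirDeriv σ p q ≤ diffQuot σ p q a :=
  ciInf_le (f := fun a : Ioi (0 : ℝ) => diffQuot σ p q a)
    ⟨-(C * ‖q‖), by rintro _ ⟨b, rfl⟩; exact h.neg_le_diffQuot p q b.2⟩ ⟨a, ha⟩

theorem abs_dirDeriv_le (p q : V) : |dirDeriv σ p q| ≤ C * ‖q‖ := by
  have : Nonempty (Ioi (0 : ℝ)) := ⟨⟨1, mem_Ioi.2 one_pos⟩⟩
  refine abs_le.2 ⟨le_ciInf fun b => h.neg_le_diffQuot p q b.2, ?_⟩
  exact (h.dirDeriv_le_diffQuot p q one_pos).trans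
    ((h.diffQuot_le p q one_pos).trans (h.le_norm q))

theorem tendsto_diffQuot (p q : V) :
    Tendsto (diffQuot σ p q) (𝓝[>] 0) (𝓝 (dirDeriv σ p q)) := by
  have : Nonempty (Ioi (0 : ℝ)) := ⟨⟨1, mem_Ioi.2 one_pos⟩⟩
  refine tendsto_order.2 ⟨fun y hy => ?_, fun y hy => ?_⟩
  · filter_upwards [self_mem_nhdsWithin] with a ha
    exact hy.trans_le (h.dirDeriv_le_diffQuot p q ha)
  · obtain ⟨b, hb⟩ := exists_lt_of_ciInf_lt hy
    filter_upwards [Ioo_mem_nhdsGT b.2] with a ha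
    exact (h.diffQuot_mono p q ha.1 ha.2.le).trans_lt hb

theorem tendsto_diffQuot_seq (p q : V) :
    Tendsto (fun k : ℕ => diffQuot σ p q (1 / ((k : ℝ) + 1))) atTop (𝓝 (dirDeriv σ p q)) := by
  refine (h.tendsto_diffQuot p q).comp (tendsto_nhdsWithin_iff.2
    ⟨tendsto_one_div_add_atTop_nhds_zero_nat, Eventually.of_forall fun k => ?_⟩)
  rw [mem_Ioi]; positivity

theorem dirDeriv_smul (p q : V) {t : ℝ} (ht : 0 < t) :
    dirDeriv σ p (t • q) = t * dirDeriv σ p q := by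
  refine tendsto_nhds_unique (h.tendsto_diffQuot p (t • q)) ?_
  have h1 : Tendsto (fun a : ℝ => a * t) (𝓝[>] 0) (𝓝[>] 0) := by
    refine tendsto_nhdsWithin_iff.2 ⟨?_, ?_⟩
    · have : Tendsto (fun a : ℝ => a * t) (𝓝 0) (𝓝 (0 * t)) := tendsto_id.mul_const t
      rw [zero_mul] at this
      exact this.mono_left nhdsWithin_le_nhds
    · filter_upwards [self_mem_nhdsWithin] with a ha
      exact mul_pos ha ht
  refine (((h.tendsto_diffQuot p q).comp h1).const_mul t).congr' ?_
  filter_upwards [self_mem_nhdsWithin] with a ha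
  have ha : 0 < a := ha
  simp only [diffQuot, Function.comp, smul_smul]
  field_simp

theorem dirDeriv_add_le (p q r : V) :
    dirDeriv σ p (q + r) ≤ dirDeriv σ p q + dirDeriv σ p r := by
  have h1 : Tendsto (fun a : ℝ => 2 * a) (𝓝[>] 0) (𝓝[>] 0) := by
    refine tendsto_nhdsWithin_iff.2 ⟨?_, ?_⟩
    · have : Tendsto (fun a : ℝ => 2 * a) (𝓝 0) (𝓝 (2 * 0)) := tendsto_id.const_mul 2
      rw [mul_zero] at this
      exact this.mono_left nhdsWithin_le_nhds
    · filter_upwards [self_mem_nhdsWithin] with a ha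
      exact mul_pos two_pos (mem_Ioi.1 ha)
  refine le_of_tendsto_of_tendsto (h.tendsto_diffQuot p (q + r))
    (((h.tendsto_diffQuot p q).comp h1).add ((h.tendsto_diffQuot p r).comp h1)) ?_
  filter_upwards [self_mem_nhdsWithin] with a ha
  have ha : 0 < a := ha
  have h2 : p + a • (q + r) = (1 / 2 : ℝ) • (p + (2 * a) • q) + (1 / 2 : ℝ) • (p + (2 * a) • r) := by
    module
  have h3 := h.add_le ((1 / 2 : ℝ) • (p + (2 * a) • q)) ((1 / 2 : ℝ) • (p + (2 * a) • r))
  rw [← h2, h.hom _ (by norm_num), h.hom _ (by norm_num)] at h3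
  simp only [diffQuot, Function.comp]
  rw [← add_div, div_le_div_iff₀ ha (by positivity)]
  nlinarith

theorem dirDeriv_zero (p : V) : dirDeriv σ p 0 = 0 := by
  have := h.abs_dirDeriv_le p 0
  rw [norm_zero, mul_zero] at this
  exact abs_nonpos_iff.1 this

theorem dirDeriv_sub_le (p q r : V) :
    dirDeriv σ p q - dirDeriv σ p r ≤ C * ‖q - r‖ := by
  have := h.dirDeriv_add_le p r (q - r)
  rw [add_sub_cancel] at this
  linarith [(abs_le.1 (h.abs_dirDeriv_le p (q - r))).2]

theorem continuous_dirDeriv (p : V) : Continuous (dirDeriv σ p) := by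
  refine (LipschitzWith.of_dist_le_mul (K := Real.toNNReal C) fun q r => ?_).continuous
  rw [Real.coe_toNNReal _ h.nonneg, Real.dist_eq, dist_eq_norm]
  refine abs_le.2 ⟨?_, h.dirDeriv_sub_le p q r⟩
  have := h.dirDeriv_sub_le p r q
  rw [norm_sub_rev] at this; linarith

/-- A derivative of a one-homogeneous function is zero-homogeneous in the base point. This makes the
level values of `ψ` irrelevant and permits relevelling. -/
theorem dirDeriv_smul_left (p q : V) {c : ℝ} (hc : 0 < c) :
    dirDeriv σ (c • p) q = dirDeriv σ p q := by
  have h1 : dirDeriv σ (c • p) (c • q) = c * dirDeriv σ p q := by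
    refine tendsto_nhds_unique (h.tendsto_diffQuot _ _)
      (((h.tendsto_diffQuot p q).const_mul c).congr fun a => ?_)
    simp only [diffQuot]
    rw [smul_comm a c q, ← smul_add, h.hom c hc.le, h.hom c hc.le]
    ring
  rw [h.dirDeriv_smul _ _ hc] at h1
  exact mul_left_cancel₀ hc.ne' h1

theorem measurable_dirDeriv [MeasurableSpace V] [BorelSpace V] [SecondCountableTopology V]
    {X : Type*} [MeasurableSpace X] {P Q : X → V} (hP : Measurable P) (hQ : Measurable Q) :
    Measurable fun x => dirDeriv σ (P x) (Q x) := by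
  refine measurable_of_tendsto_metrizable (f := fun (k : ℕ) x =>
    diffQuot σ (P x) (Q x) (1 / ((k : ℝ) + 1))) (fun k => ?_)
    (tendsto_pi_nhds.2 fun x => h.tendsto_diffQuot_seq (P x) (Q x))
  unfold diffQuot
  exact ((h.continuous.measurable.comp (hP.add (hQ.const_smul _))).sub
    (h.continuous.measurable.comp hP)).div_const _

theorem aestronglyMeasurable_dirDeriv [MeasurableSpace V] [BorelSpace V]
    [SecondCountableTopology V] {X : Type*} [MeasurableSpace X] {μ : Measure X} {P Q : X → V}
    (hP : Measurable P) (hQ : AEStronglyMeasurable Q μ) :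
    AEStronglyMeasurable (fun x => dirDeriv σ (P x) (Q x)) μ := by
  refine ⟨fun x => dirDeriv σ (P x) (hQ.mk Q x), (h.measurable_dirDeriv hP
    hQ.stronglyMeasurable_mk.measurable).stronglyMeasurable, ?_⟩
  filter_upwards [hQ.ae_eq_mk] with x hx
  rw [hx]

end IsBoundedSublinear

/-- The subgradient inequality along the ray `p + a q` bounds every difference quotient from below;
conversely the quotient at `a = 1` dominates the derivative. -/
theorem mem_subdifferential_iff {n : ℕ} {σ : EuclideanSpace ℝ (Fin n) → ℝ} {C : ℝ}
    (h : IsBoundedSublinear σ C) {p z : EuclideanSpace ℝ (Fin n)} :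
    z ∈ subdifferential σ p ↔ ∀ q, inner ℝ z q ≤ dirDeriv σ p q := by
  have : Nonempty (Ioi (0 : ℝ)) := ⟨⟨1, mem_Ioi.2 one_pos⟩⟩
  constructor
  · intro hz q
    refine le_ciInf fun a => ?_
    have ha : 0 < (a : ℝ) := a.2
    have := hz (p + (a : ℝ) • q)
    rw [add_sub_cancel_left, inner_smul_right] at this
    unfold diffQuot
    rw [le_div_iff₀ ha]
    linarith
  · intro hz q
    have h1 := (hz (q - p)).trans (h.dirDeriv_le_diffQuot p (q - p) one_pos)
    simp only [diffQuot, one_smul, add_sub_cancel, div_one] at h1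
    linarith

theorem norm_le_of_mem_subdifferential {n : ℕ} {σ : EuclideanSpace ℝ (Fin n) → ℝ} {C : ℝ}
    (h : IsBoundedSublinear σ C) {p z : EuclideanSpace ℝ (Fin n)}
    (hz : z ∈ subdifferential σ p) : ‖z‖ ≤ C := by
  have h1 := ((mem_subdifferential_iff h).1 hz z).trans
    (le_of_abs_le (h.abs_dirDeriv_le p z))
  rw [real_inner_self_eq_norm_sq] at h1
  by_contra hlt
  push Not at hlt
  have : 0 < ‖z‖ := h.nonneg.trans_lt hlt
  nlinarith

end Sublinear

/-! ### Abstract duality: a quadratic dual problem and a Hahn–Banach representation. -/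

section Hilbert

variable {X : Type*} [AddCommGroup X] [Module ℝ X]
  {H : Type*} [NormedAddCommGroup H] [InnerProductSpace ℝ H] [CompleteSpace H]

/-- A sublinear function dominating a functional `-⟪g₀, ι ·⟫` dominates one for which
`Λ := g - f` is a limit of points `ι x` along which the domination is almost an equality. -/
theorem exists_almost_tight_minorant (ι : X →ₗ[ℝ] H) (E : X → ℝ)
    (E_hom : ∀ t : ℝ, 0 < t → ∀ x, E (t • x) = t * E x)
    (E_add : ∀ x y, E (x + y) ≤ E x + E y) (f g₀ : H)
    (hg₀ : ∀ x, -inner ℝ g₀ (ι x) ≤ E x) :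
    ∃ Λ : H, (∀ x, -inner ℝ (Λ + f) (ι x) ≤ E x) ∧
      ∀ ε > 0, ∃ x, ‖ι x - Λ‖ < ε ∧ E x ≤ -inner ℝ (Λ + f) (ι x) + ε := by
  -- The dual of minimizing `‖g - f‖²/2`. It is bounded below by completing the square around `g₀ -
  -- f`.
  set J : X → ℝ := fun x => E x + 1 / 2 * ‖ι x‖ ^ 2 + inner ℝ f (ι x) with hJ
  have hbdd : BddBelow (range J) := by
    refine ⟨-(1 / 2 * ‖g₀ - f‖ ^ 2), ?_⟩
    rintro _ ⟨x, rfl⟩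
    have h1 := norm_sub_sq_real (ι x) (g₀ - f)
    have h2 := sq_nonneg ‖ι x - (g₀ - f)‖
    rw [inner_sub_right, real_inner_comm, real_inner_comm f] at h1
    have := hg₀ x
    simp only [hJ]
    linarith
  set m := ⨅ x, J x with hm
  have hmJ : ∀ x, m ≤ J x := fun x => ciInf_le hbdd x
  have hex : ∀ k : ℕ, ∃ x, J x < m + 1 / ((k : ℝ) + 1) := fun k =>
    exists_lt_of_ciInf_lt (lt_add_of_pos_right m (by positivity))
  choose x hx using hex
  have hJx : Tendsto (fun k => J (x k)) atTop (𝓝 m) := by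
    refine tendsto_of_tendsto_of_tendsto_of_le_of_le tendsto_const_nhds ?_ (fun k => hmJ _)
      (fun k => (hx k).le)
    simpa using (tendsto_one_div_add_atTop_nhds_zero_nat (𝕜 := ℝ)).const_add m
  -- The quadratic term makes `J` uniformly convex in `ι x`: comparing `J` at the midpoint with `m`
  -- shows that minimizing sequences are Cauchy after `ι`, though not in `X`.
  have hpar : ∀ k l, ‖ι (x k) - ι (x l)‖ ^ 2 ≤ 4 * (1 / ((k : ℝ) + 1) + 1 / ((l : ℝ) + 1)) := by
    intro k l
    have h1 := hmJ ((1 / 2 : ℝ) • (x k + x l))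
    simp only [hJ, map_smul, map_add, norm_smul, inner_smul_right, inner_add_right] at h1
    rw [E_hom _ (by norm_num), mul_pow] at h1
    have h2 := E_add (x k) (x l)
    have h3 := hx k
    have h4 := hx l
    have h5 := parallelogram_law_with_norm ℝ (ι (x k)) (ι (x l))
    simp only [hJ] at h3 h4
    norm_num at h1
    simp only [one_div] at *
    nlinarith
  have hcau : CauchySeq fun k => ι (x k) := by
    refine cauchySeq_of_le_tendsto_0 (fun N : ℕ => √(8 * (1 / ((N : ℝ) + 1)))) ?_ ?_
    · intro k l N hk hl
      rw [dist_eq_norm]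
      refine Real.le_sqrt_of_sq_le ((hpar k l).trans ?_)
      have a1 : 1 / ((k : ℝ) + 1) ≤ 1 / ((N : ℝ) + 1) := by gcongr
      have a2 : 1 / ((l : ℝ) + 1) ≤ 1 / ((N : ℝ) + 1) := by gcongr
      linarith
    · have := ((tendsto_one_div_add_atTop_nhds_zero_nat (𝕜 := ℝ)).const_mul 8).sqrt
      simpa using this
  obtain ⟨Λ, hΛ⟩ := cauchySeq_tendsto_of_complete hcau
  have hin : ∀ v : H, Tendsto (fun k => inner ℝ v (ι (x k))) atTop (𝓝 (inner ℝ v Λ)) :=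
    fun v => tendsto_const_nhds.inner hΛ
  have hnorm : Tendsto (fun k => ‖ι (x k)‖ ^ 2) atTop (𝓝 (‖Λ‖ ^ 2)) := hΛ.norm.pow 2
  refine ⟨Λ, fun w => ?_, ?_⟩
  -- First variation in the direction `w`, taken at `x k` because the infimum need not be attained;
  -- first `k → ∞`, then `t → 0`.
  · have key : ∀ t : ℝ, 0 < t →
        0 ≤ E w + inner ℝ (ι w) Λ + t / 2 * ‖ι w‖ ^ 2 + inner ℝ f (ι w) := by
      intro t ht
      have h1 : ∀ k, m - J (x k) ≤ t * (E w + inner ℝ (ι w) (ι (x k)) + t / 2 * ‖ι w‖ ^ 2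
          + inner ℝ f (ι w)) := by
        intro k
        have h2 := hmJ (x k + t • w)
        have h3 := E_add (x k) (t • w)
        rw [E_hom t ht] at h3
        simp only [hJ, map_smul, map_add, inner_add_right, inner_smul_right] at h2 ⊢
        rw [norm_add_sq_real, inner_smul_right, norm_smul, mul_pow, Real.norm_eq_abs, sq_abs,
          real_inner_comm] at h2
        linarith
      have h2 := le_of_tendsto_of_tendsto' (hJx.const_sub m)
        (((((hin (ι w)).const_add (E w)).add_const (t / 2 * ‖ι w‖ ^ 2)).add_const
          (inner ℝ f (ι w))).const_mul t) h1
      rw [sub_self] at h2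
      exact nonneg_of_mul_nonneg_right h2 ht
    have h3 : 0 ≤ E w + inner ℝ (ι w) Λ + inner ℝ f (ι w) := by
      have h4 : Tendsto (fun t : ℝ => E w + inner ℝ (ι w) Λ + t / 2 * ‖ι w‖ ^ 2 + inner ℝ f (ι w))
          (𝓝[>] 0) (𝓝 (E w + inner ℝ (ι w) Λ + 0 / 2 * ‖ι w‖ ^ 2 + inner ℝ f (ι w))) :=
        (Continuous.tendsto (by fun_prop) 0).mono_left nhdsWithin_le_nhds
      have h5 := ge_of_tendsto h4 (by
        filter_upwards [self_mem_nhdsWithin] with t ht using key t ht)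
      simpa using h5
    rw [inner_add_left, real_inner_comm (ι w) Λ]
    linarith
  -- An Euler relation: `J` without its quadratic term is positively homogeneous, so testing `m`
  -- against `s • x k` with `s < 1` and letting `k → ∞`, then `s → 1`, gives the bound. It forces
  -- the limit of `E + ⟪Λ + f, ι ·⟫` along `x k` to be at most `0`.
  · have hmΛ : m ≤ -(1 / 2 * ‖Λ‖ ^ 2) := by
      have key : ∀ s : ℝ, s ∈ Ioo (0 : ℝ) 1 → m ≤ -(1 / 2 * s * ‖Λ‖ ^ 2) := by
        rintro s ⟨hs0, hs1⟩
        have h1 : ∀ k, m ≤ s * (J (x k) - 1 / 2 * ‖ι (x k)‖ ^ 2)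
            + 1 / 2 * s ^ 2 * ‖ι (x k)‖ ^ 2 := by
          intro k
          have h2 := hmJ (s • x k)
          simp only [hJ, map_smul, inner_smul_right] at h2 ⊢
          rw [E_hom s hs0, norm_smul, mul_pow, Real.norm_eq_abs, sq_abs] at h2
          linarith
        have h2 := ge_of_tendsto' (((hJx.sub (hnorm.const_mul (1 / 2))).const_mul s).add
          (hnorm.const_mul (1 / 2 * s ^ 2))) h1
        have h3 : 0 ≤ (1 - s) * (-(1 / 2 * s * ‖Λ‖ ^ 2) - m) := by linarith
        have := nonneg_of_mul_nonneg_right h3 (by linarith)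
        linarith
      have h4 : Tendsto (fun s : ℝ => -(1 / 2 * s * ‖Λ‖ ^ 2)) (𝓝[<] 1)
          (𝓝 (-(1 / 2 * 1 * ‖Λ‖ ^ 2))) :=
        (Continuous.tendsto (by fun_prop) 1).mono_left nhdsWithin_le_nhds
      have h5 := ge_of_tendsto h4 (by
        filter_upwards [Ioo_mem_nhdsLT (zero_lt_one' ℝ)] with s hs using key s hs)
      simpa using h5
    intro ε hε
    have h1 : ∀ᶠ k in atTop, ‖ι (x k) - Λ‖ < ε := by
      have := (tendsto_iff_norm_sub_tendsto_zero.1 hΛ)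
      exact this.eventually_lt_const hε
    have h2 : ∀ᶠ k in atTop, J (x k) - 1 / 2 * ‖ι (x k)‖ ^ 2 + inner ℝ Λ (ι (x k)) < ε := by
      refine ((hJx.sub (hnorm.const_mul (1 / 2))).add (hin Λ)).eventually_lt_const ?_
      rw [real_inner_self_eq_norm_sq]
      linarith
    obtain ⟨k, hk1, hk2⟩ := (h1.and h2).exists
    refine ⟨x k, hk1, ?_⟩
    simp only [hJ] at hk2
    rw [inner_add_left]
    linarith

/-- A linear functional dominated by a continuous sublinear function of `A x` is represented by
a vector dominated by that function. -/
theorem exists_representative_of_le_sublinear (A : X →ₗ[ℝ] H) (N : H → ℝ)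
    (N_hom : ∀ c : ℝ, 0 < c → ∀ y, N (c • y) = c * N y)
    (N_add : ∀ y y', N (y + y') ≤ N y + N y') (K : ℝ) (hK : ∀ y, N y ≤ K * ‖y‖)
    (l : X →ₗ[ℝ] ℝ) (hl : ∀ x, l x ≤ N (A x)) :
    ∃ z : H, (∀ x, inner ℝ z (A x) = l x) ∧ ∀ y, inner ℝ z y ≤ N y := by
  obtain ⟨s, hs⟩ := A.rangeRestrict.exists_rightInverse_of_surjective A.range_rangeRestrict
  have hs' : ∀ y : LinearMap.range A, A (s y) = y := fun y => by
    have := congrArg (fun φ => ((φ y : LinearMap.range A) : H)) hs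
    simpa using this
  have hN0 : N 0 ≤ 0 := by simpa using hK 0
  -- Hence `l` factors through the range of `A`, and the linear section `s` writes the factor
  -- explicitly.
  have hker : ∀ x, A x = 0 → l x = 0 := by
    intro x hx
    have h1 := hl x
    have h2 := hl (-x)
    rw [map_neg, map_neg, hx, neg_zero] at h2
    rw [hx] at h1
    linarith
  have hls : ∀ x, l (s ⟨A x, LinearMap.mem_range_self A x⟩) = l x := by
    intro x
    have : l (s ⟨A x, LinearMap.mem_range_self A x⟩ - x) = 0 := by
      apply hker
      rw [map_sub, hs', sub_self]
    rwa [map_sub, sub_eq_zero] at this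
  obtain ⟨F, hF1, hF2⟩ := exists_extension_of_le_sublinear ⟨LinearMap.range A, l ∘ₗ s⟩ N N_hom N_add
    (by
      intro y
      change l (s y) ≤ N y
      have := hl (s y)
      rwa [hs'] at this)
  have hFb : ∀ y, ‖F y‖ ≤ K * ‖y‖ := by
    intro y
    rw [Real.norm_eq_abs, abs_le]
    have h1 := (hF2 (-y)).trans (hK (-y))
    rw [map_neg, norm_neg] at h1
    exact ⟨by linarith, (hF2 y).trans (hK y)⟩
  let F' : StrongDual ℝ H := F.mkContinuous K hFb
  refine ⟨(InnerProductSpace.toDual ℝ H).symm F', fun x => ?_, fun y => ?_⟩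
  · rw [InnerProductSpace.toDual_symm_apply]
    change F (A x) = l x
    exact (hF1 ⟨A x, LinearMap.mem_range_self A x⟩).trans (hls x)
  · rw [InnerProductSpace.toDual_symm_apply]
    exact hF2 y

end Hilbert

/-! ### Test functions, the energy, and construction of Cahn–Hoffman fields. -/

section Field

variable {n : ℕ}

/-- Smooth functions with compact support in `U`. -/
def testFunctions (U : Set (EuclideanSpace ℝ (Fin n))) :
    Submodule ℝ (EuclideanSpace ℝ (Fin n) → ℝ) where
  carrier := {w | ContDiff ℝ ∞ w ∧ HasCompactSupport w ∧ tsupport w ⊆ U}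
  zero_mem' := ⟨contDiff_const, HasCompactSupport.zero, by simp [tsupport]⟩
  add_mem' := fun {v w} hv hw => ⟨hv.1.add hw.1, hv.2.1.add hw.2.1,
    (tsupport_add v w).trans (union_subset hv.2.2 hw.2.2)⟩
  smul_mem' := fun c w hw => ⟨contDiff_const.smul hw.1, hw.2.1.smul_left (f := fun _ => c),
    (tsupport_smul_subset_right (fun _ => c) w).trans hw.2.2⟩

/-- The energy `∫_U σ'(∇ψ; ∇w)`. -/
noncomputable def energy (σ ψ : EuclideanSpace ℝ (Fin n) → ℝ) (U : Set (EuclideanSpace ℝ (Fin n)))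
    (w : EuclideanSpace ℝ (Fin n) → ℝ) : ℝ :=
  ∫ x in U, dirDeriv σ (gradient ψ x) (gradient w x)

theorem measurable_gradient (w : EuclideanSpace ℝ (Fin n) → ℝ) : Measurable (gradient w) := by
  unfold gradient
  exact (InnerProductSpace.toDual ℝ _).symm.continuous.measurable.comp (measurable_fderiv ℝ w)

theorem gradient_add' {v w : EuclideanSpace ℝ (Fin n) → ℝ} {x : EuclideanSpace ℝ (Fin n)}
    (hv : DifferentiableAt ℝ v x) (hw : DifferentiableAt ℝ w x) :
    gradient (v + w) x = gradient v x + gradient w x := by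
  simp [gradient, fderiv_add hv hw]

theorem gradient_smul' {w : EuclideanSpace ℝ (Fin n) → ℝ} {x : EuclideanSpace ℝ (Fin n)}
    (c : ℝ) (hw : DifferentiableAt ℝ w x) :
    gradient (c • w) x = c • gradient w x := by
  simp [gradient, fderiv_const_smul hw]

theorem hasCompactSupport_gradient {w : EuclideanSpace ℝ (Fin n) → ℝ} (hw : HasCompactSupport w) :
    HasCompactSupport (gradient w) := by
  refine (hw.fderiv (𝕜 := ℝ)).comp_left (g := (InnerProductSpace.toDual ℝ _).symm) (map_zero _)

theorem continuous_gradient {w : EuclideanSpace ℝ (Fin n) → ℝ} (hw : ContDiff ℝ ∞ w) :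
    Continuous (gradient w) :=
  (InnerProductSpace.toDual ℝ _).symm.continuous.comp (hw.continuous_fderiv (by simp))

theorem norm_gradient (w : EuclideanSpace ℝ (Fin n) → ℝ) (x : EuclideanSpace ℝ (Fin n)) :
    ‖gradient w x‖ = ‖fderiv ℝ w x‖ := by
  simp [gradient]

variable {U : Set (EuclideanSpace ℝ (Fin n))}

theorem testFunctions.differentiable {w : EuclideanSpace ℝ (Fin n) → ℝ}
    (hw : w ∈ testFunctions U) : Differentiable ℝ w := hw.1.differentiable (by simp)

theorem testFunctions.integrable_gradient {w : EuclideanSpace ℝ (Fin n) → ℝ}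
    (hw : w ∈ testFunctions U) : Integrable (gradient w) (volume.restrict U) :=
  ((continuous_gradient hw.1).integrable_of_hasCompactSupport
    (hasCompactSupport_gradient hw.2.1)).restrict

theorem testFunctions.memLp {w : EuclideanSpace ℝ (Fin n) → ℝ}
    (hw : w ∈ testFunctions U) : MemLp w 2 (volume.restrict U) :=
  (hw.1.continuous.memLp_of_hasCompactSupport hw.2.1).restrict U

variable {σ : EuclideanSpace ℝ (Fin n) → ℝ} {C : ℝ}

theorem integrable_dirDeriv (h : IsBoundedSublinear σ C) {X : Type*} [MeasurableSpace X]
    {μ : Measure X} {P Q : X → EuclideanSpace ℝ (Fin n)} (hP : Measurable P)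
    (hQ : Integrable Q μ) : Integrable (fun x => dirDeriv σ (P x) (Q x)) μ :=
  (hQ.norm.const_mul C).mono' (h.aestronglyMeasurable_dirDeriv hP hQ.aestronglyMeasurable)
    (Eventually.of_forall fun x => h.abs_dirDeriv_le (P x) (Q x))

theorem energy_smul (h : IsBoundedSublinear σ C) (ψ : EuclideanSpace ℝ (Fin n) → ℝ) {t : ℝ}
    (ht : 0 < t) {w : EuclideanSpace ℝ (Fin n) → ℝ} (hw : w ∈ testFunctions U) :
    energy σ ψ U (t • w) = t * energy σ ψ U w := by
  unfold energy
  rw [← integral_const_mul]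
  refine integral_congr_ae (Eventually.of_forall fun x => ?_)
  simp only
  rw [gradient_smul' t (testFunctions.differentiable hw x), h.dirDeriv_smul _ _ ht]

theorem energy_add_le (h : IsBoundedSublinear σ C) (ψ : EuclideanSpace ℝ (Fin n) → ℝ)
    {v w : EuclideanSpace ℝ (Fin n) → ℝ} (hv : v ∈ testFunctions U) (hw : w ∈ testFunctions U) :
    energy σ ψ U (v + w) ≤ energy σ ψ U v + energy σ ψ U w := by
  unfold energy
  have i1 := fun u (hu : u ∈ testFunctions U) => integrable_dirDeriv h
    (measurable_gradient ψ) (testFunctions.integrable_gradient hu)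
  rw [← integral_add (i1 v hv) (i1 w hw)]
  refine integral_mono (i1 _ (add_mem hv hw)) ((i1 v hv).add (i1 w hw)) fun x => ?_
  simp only
  rw [gradient_add' (testFunctions.differentiable hv x) (testFunctions.differentiable hw x)]
  exact h.dirDeriv_add_le _ _ _

/-- Fields of the form `1_s q` localize the integral inequality to almost every point for one fixed
`q`; a countable dense set of `q` and continuity in `q` give a common null set. -/
theorem inner_le_dirDeriv_of_forall_setIntegral (h : IsBoundedSublinear σ C)
    {X : Type*} [MeasurableSpace X] {μ : Measure X} [IsFiniteMeasure μ]
    {P : X → EuclideanSpace ℝ (Fin n)} (hP : Measurable P)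
    (z : Lp (EuclideanSpace ℝ (Fin n)) 2 μ)
    (hz : ∀ q : Lp (EuclideanSpace ℝ (Fin n)) 2 μ, inner ℝ z q ≤ ∫ x, dirDeriv σ (P x) (q x) ∂μ) :
    ∀ᵐ x ∂μ, z x ∈ subdifferential σ (P x) := by
  have h1 : ∀ q : EuclideanSpace ℝ (Fin n), ∀ᵐ x ∂μ, inner ℝ (z x) q ≤ dirDeriv σ (P x) q := by
    intro q
    have hi1 : Integrable (fun x => inner ℝ (z x) q) μ :=
      ((Lp.memLp z).integrable one_le_two).inner_const q
    have hi2 : Integrable (fun x => dirDeriv σ (P x) q) μ :=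
      integrable_dirDeriv h hP (integrable_const q)
    refine ae_le_of_forall_setIntegral_le hi1 hi2 fun s hs hμs => ?_
    have := hz (indicatorConstLp 2 hs hμs.ne q)
    rw [L2.inner_def] at this
    calc ∫ x in s, inner ℝ (z x) q ∂μ
        = ∫ x, inner ℝ (z x) (indicatorConstLp 2 hs hμs.ne q x) ∂μ := by
          rw [← integral_indicator hs]
          refine integral_congr_ae ?_
          filter_upwards [indicatorConstLp_coeFn (p := 2) (hs := hs) (hμs := hμs.ne) (c := q)]
            with x hx
          rw [hx]
          by_cases hxs : x ∈ s <;> simp [hxs]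
      _ ≤ _ := this
      _ = ∫ x in s, dirDeriv σ (P x) q ∂μ := by
          rw [← integral_indicator hs]
          refine integral_congr_ae ?_
          filter_upwards [indicatorConstLp_coeFn (p := 2) (hs := hs) (hμs := hμs.ne) (c := q)]
            with x hx
          rw [hx]
          by_cases hxs : x ∈ s <;> simp [hxs, h.dirDeriv_zero]
  obtain ⟨S, hSc, hSd⟩ := TopologicalSpace.exists_countable_dense (EuclideanSpace ℝ (Fin n))
  filter_upwards [(ae_ball_iff hSc).2 fun q _ => h1 q] with x hx
  refine (mem_subdifferential_iff h).2 fun q => ?_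
  have hcl : IsClosed {q | inner ℝ (z x) q ≤ dirDeriv σ (P x) q} :=
    isClosed_le (by fun_prop) (h.continuous_dirDeriv _)
  have : closure S ⊆ {q | inner ℝ (z x) q ≤ dirDeriv σ (P x) q} :=
    hcl.closure_subset_iff.2 fun q hq => hx q hq
  exact this (hSd q)

/-- A strictly positive continuous weight of finite mass. -/
noncomputable def weight (x : EuclideanSpace ℝ (Fin n)) : ℝ := (1 + ‖x‖) ^ (-((n : ℝ) + 1))

theorem weight_pos (x : EuclideanSpace ℝ (Fin n)) : 0 < weight x := by
  unfold weight; positivity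

theorem continuous_weight : Continuous (weight : EuclideanSpace ℝ (Fin n) → ℝ) := by
  unfold weight
  refine Continuous.rpow_const (by fun_prop) fun x => Or.inl ?_
  have := norm_nonneg x
  linarith

theorem integrable_weight : Integrable (weight : EuclideanSpace ℝ (Fin n) → ℝ) volume := by
  unfold weight
  exact integrable_one_add_norm (by simp)

/-- The weighted measure on `U`. -/
noncomputable def weighted (U : Set (EuclideanSpace ℝ (Fin n))) :
    Measure (EuclideanSpace ℝ (Fin n)) :=
  (volume.restrict U).withDensity fun x => ENNReal.ofReal (weight x)

instance : IsFiniteMeasure (weighted U) :=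
  isFiniteMeasure_withDensity_ofReal integrable_weight.restrict.2

theorem ae_weighted_iff {p : EuclideanSpace ℝ (Fin n) → Prop} :
    (∀ᵐ x ∂weighted U, p x) ↔ ∀ᵐ x ∂volume.restrict U, p x := by
  unfold weighted
  rw [ae_withDensity_iff continuous_weight.measurable.ennreal_ofReal]
  simp [weight_pos]

theorem integral_weighted (g : EuclideanSpace ℝ (Fin n) → ℝ) :
    ∫ x, g x ∂weighted U = ∫ x in U, weight x * g x := by
  unfold weighted
  rw [integral_withDensity_eq_integral_toReal_smul
    continuous_weight.measurable.ennreal_ofReal (by simp)]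
  simp [ENNReal.toReal_ofReal (weight_pos _).le]

theorem memLp_gradient_div_weight {w : EuclideanSpace ℝ (Fin n) → ℝ} (hw : w ∈ testFunctions U) :
    MemLp (fun x => (weight x)⁻¹ • gradient w x) 2 (weighted U) := by
  refine Continuous.memLp_of_hasCompactSupport ?_ ?_
  · exact (continuous_weight.inv₀ fun x => (weight_pos x).ne').smul (continuous_gradient hw.1)
  · exact (hasCompactSupport_gradient hw.2.1).smul_left (f := fun x => (weight x)⁻¹)

/-- A function `g ∈ L²` dominated by the energy is the divergence of a Cahn–Hoffman field. -/
theorem exists_cahnHoffman_of_le_energy (h : IsBoundedSublinear σ C)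
    (ψ : EuclideanSpace ℝ (Fin n) → ℝ) {g : EuclideanSpace ℝ (Fin n) → ℝ}
    (hg : MemLp g 2 (volume.restrict U))
    (hge : ∀ w ∈ testFunctions U, -∫ x in U, g x * w x ≤ energy σ ψ U w) :
    ∃ z ∈ CahnHoffman σ ψ U, HasL2Divergence U z g := by
  -- `U` may have infinite measure, where `L²` fields need not be integrable; the finite weighted
  -- measure repairs this. Dividing the gradient by the weight restores the unweighted pairing `∫_U
  -- z · ∇w`, and homogeneity of `dirDeriv` does the same for the energy.
  let A : testFunctions U →ₗ[ℝ] Lp (EuclideanSpace ℝ (Fin n)) 2 (weighted U) :=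
    { toFun := fun w => (memLp_gradient_div_weight w.2).toLp _
      map_add' := fun v w => by
        rw [← MemLp.toLp_add]
        congr 1
        ext1 x
        simp only [Submodule.coe_add, Pi.add_apply]
        rw [gradient_add' (testFunctions.differentiable v.2 x)
          (testFunctions.differentiable w.2 x), smul_add]
      map_smul' := fun c w => by
        rw [RingHom.id_apply, ← MemLp.toLp_const_smul]
        congr 1
        ext1 x
        simp only [Submodule.coe_smul, Pi.smul_apply]
        rw [gradient_smul' c (testFunctions.differentiable w.2 x), smul_comm] }
  have hint : ∀ w ∈ testFunctions U, Integrable (fun x => g x * w x) (volume.restrict U) :=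
    fun w hw => hg.integrable_mul (testFunctions.memLp hw)
  let l : testFunctions U →ₗ[ℝ] ℝ :=
    { toFun := fun w => -∫ x in U, g x * (w : EuclideanSpace ℝ (Fin n) → ℝ) x
      map_add' := fun v w => by
        simp only [Submodule.coe_add, Pi.add_apply, mul_add]
        rw [integral_add (hint v v.2) (hint w w.2)]
        ring
      map_smul' := fun c w => by
        simp only [Submodule.coe_smul, Pi.smul_apply, smul_eq_mul, RingHom.id_apply]
        rw [mul_neg, ← integral_const_mul]
        congr 2
        ext1 x
        ring }
  let N : Lp (EuclideanSpace ℝ (Fin n)) 2 (weighted U) → ℝ := fun q => ∫ x, dirDeriv σ (gradient ψ x) (q x) ∂weighted U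
  have hqi : ∀ q : Lp (EuclideanSpace ℝ (Fin n)) 2 (weighted U), Integrable q (weighted U) := fun q =>
    (Lp.memLp q).integrable one_le_two
  have hNi := fun q => integrable_dirDeriv h (measurable_gradient ψ) (hqi q)
  obtain ⟨z, hz1, hz2⟩ := exists_representative_of_le_sublinear A N
    (by
      intro c hc q
      simp only [N]
      rw [← integral_const_mul]
      refine integral_congr_ae ?_
      filter_upwards [Lp.coeFn_smul c q] with x hx
      rw [hx, Pi.smul_apply, h.dirDeriv_smul _ _ hc])
    (by
      intro q r
      simp only [N]
      rw [← integral_add (hNi q) (hNi r)]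
      refine integral_mono_ae (hNi _) ((hNi q).add (hNi r)) ?_
      filter_upwards [Lp.coeFn_add q r] with x hx
      rw [hx]
      exact h.dirDeriv_add_le _ _ _)
    -- Cauchy–Schwarz: the `L¹` norm is at most the root of the total mass times the `L²` norm.
    (C * √((weighted U).real univ))
    (by
      intro q
      calc N q ≤ ∫ x, C * ‖q x‖ ∂weighted U :=
            integral_mono (hNi q) ((hqi q).norm.const_mul C) fun x =>
              (le_abs_self _).trans (h.abs_dirDeriv_le _ _)
        _ = C * ∫ x, ‖q x‖ ∂weighted U := integral_const_mul _ _
        _ ≤ C * (√((weighted U).real univ) * ‖q‖) := by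
            refine mul_le_mul_of_nonneg_left ?_ h.nonneg
            rw [integral_norm_eq_lintegral_enorm (Lp.aestronglyMeasurable q), Lp.norm_def,
              ← eLpNorm_one_eq_lintegral_enorm]
            have := eLpNorm_le_eLpNorm_mul_rpow_measure_univ (μ := weighted U) (f := q) (p := 1) (q := 2)
              one_le_two (Lp.aestronglyMeasurable q)
            have h2 := ENNReal.toReal_mono (ENNReal.mul_ne_top (Lp.eLpNorm_ne_top q)
              (ENNReal.rpow_ne_top_of_nonneg (by norm_num) (measure_ne_top (weighted U) univ))) this
            rw [ENNReal.toReal_mul, ← ENNReal.toReal_rpow, mul_comm,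
              show 1 / (1 : ℝ≥0∞).toReal - 1 / (2 : ℝ≥0∞).toReal = 1 / 2 by norm_num,
              ← Real.sqrt_eq_rpow] at h2
            exact h2
        _ = _ := by ring)
    l
    (by
      intro w
      refine (hge w w.2).trans_eq ?_
      simp only [N, A, energy]
      have : ∀ᵐ x ∂weighted U, dirDeriv σ (gradient ψ x) ((A w) x) =
          dirDeriv σ (gradient ψ x) ((weight x)⁻¹ • gradient w.1 x) := by
        filter_upwards [(memLp_gradient_div_weight w.2).coeFn_toLp] with x hx
        exact congrArg _ hx
      refine Eq.trans ?_ (integral_congr_ae this).symm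
      rw [integral_weighted]
      refine integral_congr_ae (Eventually.of_forall fun x => ?_)
      simp only
      rw [h.dirDeriv_smul _ _ (inv_pos.2 (weight_pos x)), mul_inv_cancel_left₀ (weight_pos x).ne'])
  have hsub : ∀ᵐ x ∂volume.restrict U, z x ∈ subdifferential σ (gradient ψ x) :=
    ae_weighted_iff.1 (inner_le_dirDeriv_of_forall_setIntegral h (measurable_gradient ψ) z hz2)
  have hzL : HasL2Divergence U z g := by
    refine ⟨?_, hg, ?_⟩
    · refine memLp_top_of_bound (Lp.stronglyMeasurable z).aestronglyMeasurable C ?_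
      filter_upwards [hsub] with x hx using norm_le_of_mem_subdifferential h hx
    · intro φ h1 h2 h3
      have hw : φ ∈ testFunctions U := ⟨h1, h2, h3⟩
      have h4 : inner ℝ z (A ⟨φ, hw⟩) = -∫ x in U, g x * φ x := hz1 ⟨φ, hw⟩
      rw [← h4, L2.inner_def]
      have : ∀ᵐ x ∂weighted U, inner ℝ (z x) ((A ⟨φ, hw⟩) x) =
          inner ℝ (z x) ((weight x)⁻¹ • gradient φ x) := by
        filter_upwards [(memLp_gradient_div_weight hw).coeFn_toLp] with x hx
        exact congrArg _ hx
      refine Eq.trans ?_ (integral_congr_ae this).symm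
      rw [integral_weighted]
      refine integral_congr_ae (Eventually.of_forall fun x => ?_)
      simp only
      rw [inner_smul_right, mul_inv_cancel_left₀ (weight_pos x).ne']
  exact ⟨z, ⟨⟨g, hzL⟩, hsub⟩, hzL⟩

end Field

/-! ### Existence and uniqueness of the optimal divergence, and almost tight test functions. -/

section Duality

variable {n : ℕ} {U : Set (EuclideanSpace ℝ (Fin n))} {σ : EuclideanSpace ℝ (Fin n) → ℝ} {C : ℝ}

/-- Integrates `z · ∇v ≤ σ'(∇ψ; ∇v)`. The integration by parts is a hypothesis so that both smooth
and Lipschitz `v` are covered. -/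
theorem neg_integral_le_integral_dirDeriv (h : IsBoundedSublinear σ C)
    {ψ g v : EuclideanSpace ℝ (Fin n) → ℝ}
    {z : EuclideanSpace ℝ (Fin n) → EuclideanSpace ℝ (Fin n)}
    (hz : ∀ᵐ x ∂volume.restrict U, z x ∈ subdifferential σ (gradient ψ x))
    (hzm : MemLp z ∞ (volume.restrict U)) (hv : Integrable (gradient v) (volume.restrict U))
    (hdiv : ∫ x in U, inner ℝ (z x) (gradient v x) = -∫ x in U, g x * v x) :
    -∫ x in U, g x * v x ≤ energy σ ψ U v := by
  rw [← hdiv]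
  refine integral_mono_ae ?_ (integrable_dirDeriv h (measurable_gradient ψ) hv) ?_
  · refine (hv.norm.const_mul C).mono' (hzm.1.inner hv.1) ?_
    filter_upwards [hz] with x hx
    exact (norm_inner_le_norm _ _).trans
      (by gcongr; exact norm_le_of_mem_subdifferential h hx)
  · filter_upwards [hz] with x hx
    exact (mem_subdifferential_iff h).1 hx _

theorem inner_toLp_eq {α : Type*} [MeasurableSpace α] {μ : Measure α} {g w : α → ℝ}
    (hg : MemLp g 2 μ) (hw : MemLp w 2 μ) :
    inner ℝ (hg.toLp g) (hw.toLp w) = ∫ x, g x * w x ∂μ := by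
  rw [L2.inner_def]
  refine integral_congr_ae ?_
  filter_upwards [hg.coeFn_toLp, hw.coeFn_toLp] with x h1 h2
  rw [h1, h2, mul_comm]
  simp

theorem eLpNorm_sub_eq_ofReal {α : Type*} [MeasurableSpace α] {μ : Measure α} {g w : α → ℝ}
    (hg : MemLp g 2 μ) (hw : MemLp w 2 μ) :
    eLpNorm (g - w) 2 μ = ENNReal.ofReal ‖hg.toLp g - hw.toLp w‖ := by
  rw [← MemLp.toLp_sub, Lp.norm_toLp, ENNReal.ofReal_toReal (hg.sub hw).2.ne]

/-- The last clause is what the comparison uses: `g - f` is only an `L²` function and has no energy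
of its own, so almost optimal test functions stand in for it. -/
theorem exists_isMinimizer (h : IsBoundedSublinear σ C) {ψ f : EuclideanSpace ℝ (Fin n) → ℝ}
    (hf : MemLp f 2 (volume.restrict U)) (hCH : (CahnHoffman σ ψ U).Nonempty) :
    ∃ z g, IsMinimizer σ U ψ f z g ∧
      (∀ z' g', IsMinimizer σ U ψ f z' g' → g' =ᵐ[volume.restrict U] g) ∧
      ∀ ε > 0, ∃ w ∈ testFunctions U, ∫ x in U, (w x - (g x - f x)) ^ 2 ≤ ε ^ 2 ∧
        energy σ ψ U w ≤ -(∫ x in U, g x * w x) + ε := by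
  let ι : testFunctions U →ₗ[ℝ] Lp ℝ 2 (volume.restrict U) :=
    { toFun := fun w => (testFunctions.memLp w.2).toLp _
      map_add' := fun v w => rfl
      map_smul' := fun c w => rfl }
  have hmin : ∀ z ∈ CahnHoffman σ ψ U, ∀ g, ∀ hzg : HasL2Divergence U z g, ∀ w : testFunctions U,
      -inner ℝ (hzg.div_memLp.toLp g) (ι w) ≤ energy σ ψ U w := by
    intro z hz g hzg w
    have h1 : inner ℝ (hzg.div_memLp.toLp g) (ι w) = _ :=
      inner_toLp_eq hzg.div_memLp (testFunctions.memLp w.2)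
    rw [h1]
    exact neg_integral_le_integral_dirDeriv h hz.2 hzg.field_memLp
      (testFunctions.integrable_gradient w.2) (hzg.div_eq w w.2.1 w.2.2.1 w.2.2.2)
  obtain ⟨z₀, hz₀⟩ := hCH
  obtain ⟨g₀, hg₀⟩ := hz₀.1
  obtain ⟨Λ, hΛ1, hΛ2⟩ := exists_almost_tight_minorant ι (fun w => energy σ ψ U w)
    (fun t ht w => energy_smul h ψ ht w.2) (fun v w => energy_add_le h ψ v.2 w.2)
    (hf.toLp f) (hg₀.div_memLp.toLp g₀) (hmin z₀ hz₀ g₀ hg₀)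
  set G : Lp ℝ 2 (volume.restrict U) := Λ + hf.toLp f with hG
  have hGm : MemLp G 2 (volume.restrict U) := Lp.memLp G
  have hGt : hGm.toLp G = G := Lp.toLp_coeFn G hGm
  have hGi : ∀ w : testFunctions U, inner ℝ G (ι w) = ∫ x in U, G x * w.1 x := by
    intro w
    rw [← inner_toLp_eq hGm (testFunctions.memLp w.2), hGt]
    rfl
  obtain ⟨z, hz, hzG⟩ := exists_cahnHoffman_of_le_energy h ψ hGm (by
    intro w hw
    rw [← hGi ⟨w, hw⟩]
    exact hΛ1 ⟨w, hw⟩)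
  -- The obtuse-angle inequality of a projection. It yields both minimality of `G` and uniqueness of
  -- the divergence.
  have hkey : ∀ z' ∈ CahnHoffman σ ψ U, ∀ g', ∀ hzg : HasL2Divergence U z' g',
      ‖Λ‖ ^ 2 + ‖hzg.div_memLp.toLp g' - G‖ ^ 2 ≤ ‖hzg.div_memLp.toLp g' - hf.toLp f‖ ^ 2 := by
    intro z' hz' g' hzg
    set G' := hzg.div_memLp.toLp g'
    have h1 : 0 ≤ inner ℝ (G' - G) Λ := by
      refine le_of_forall_pos_le_add fun δ hδ => ?_
      -- From `-⟪G', ι x⟫ ≤ E x ≤ -⟪G, ι x⟫ + ε` follows `⟪G' - G, ι x⟫ ≥ -ε`. This `ε` makes that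
      -- error and the cost of replacing `ι x` by `Λ` add up to `δ`.
      obtain ⟨x, hx1, hx2⟩ := hΛ2 (δ / (1 + ‖G' - G‖)) (by positivity)
      have h2 := (hmin z' hz' g' hzg x).trans hx2
      have h3 := real_inner_le_norm (G' - G) (ι x - Λ)
      rw [inner_sub_right, inner_sub_left] at h3
      have h4 : ‖G' - G‖ * ‖ι x - Λ‖ ≤ ‖G' - G‖ * (δ / (1 + ‖G' - G‖)) := by gcongr
      have h5 : ‖G' - G‖ * (δ / (1 + ‖G' - G‖)) + δ / (1 + ‖G' - G‖) = δ := by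
        field_simp
        ring
      linarith
    have h2 : G' - hf.toLp f = Λ + (G' - G) := by rw [hG]; abel
    rw [h2, norm_add_sq_real, real_inner_comm]
    linarith
  have hΛ : G - hf.toLp f = Λ := by rw [hG]; abel
  have hGf : eLpNorm ((G : EuclideanSpace ℝ (Fin n) → ℝ) - f) 2 (volume.restrict U) = ENNReal.ofReal ‖Λ‖ := by
    rw [eLpNorm_sub_eq_ofReal hGm hf, hGt, hΛ]
  refine ⟨z, G, ⟨hz, hzG, fun z' hz' g' hzg => ?_⟩, fun z' g' hm => ?_, fun ε hε => ?_⟩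
  · rw [hGf, eLpNorm_sub_eq_ofReal hzg.div_memLp hf]
    refine ENNReal.ofReal_le_ofReal (le_of_sq_le_sq ?_ (norm_nonneg _))
    nlinarith [hkey z' hz' g' hzg, sq_nonneg ‖hzg.div_memLp.toLp g' - G‖]
  · have h1 := hm.2.2 z hz G hzG
    rw [hGf, eLpNorm_sub_eq_ofReal hm.2.1.div_memLp hf,
      ENNReal.ofReal_le_ofReal_iff (norm_nonneg _)] at h1
    have h2 := hkey z' hm.1 g' hm.2.1
    have h3 := pow_le_pow_left₀ (norm_nonneg _) h1 2
    have h4 : ‖hm.2.1.div_memLp.toLp g' - G‖ = 0 := by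
      rw [← sq_eq_zero_iff]
      exact le_antisymm (by linarith) (sq_nonneg _)
    have h5 := sub_eq_zero.1 (norm_eq_zero.1 h4)
    have h6 := hm.2.1.div_memLp.coeFn_toLp
    rw [h5] at h6
    exact h6.symm
  · obtain ⟨w, hw1, hw2⟩ := hΛ2 ε hε
    refine ⟨w, w.2, ?_, ?_⟩
    · have h1 : ∫ x in U, (w.1 x - (G x - f x)) ^ 2 = ‖ι w - Λ‖ ^ 2 := by
        rw [← real_inner_self_eq_norm_sq, ← hΛ, L2.inner_def]
        refine integral_congr_ae ?_
        filter_upwards [Lp.coeFn_sub (ι w) (G - hf.toLp f), Lp.coeFn_sub G (hf.toLp f),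
          hf.coeFn_toLp, (testFunctions.memLp w.2).coeFn_toLp] with x h1 h2 h3 h4
        have h4 : (ι w) x = w.1 x := h4
        rw [h1, Pi.sub_apply, h2, Pi.sub_apply, h3, h4]
        simp [sq]
      rw [h1]
      exact pow_le_pow_left₀ (norm_nonneg _) hw1.le 2
    · rw [← hGi w]
      exact hw2

end Duality

/-! ### Lipschitz functions as test functions. -/

section Lipschitz

variable {n : ℕ}

/-- Where `v` vanishes, `|v|` has a minimum, so its derivative is zero wherever it exists; by
Rademacher this is almost everywhere. -/
theorem gradient_eq_zero_of_zero_ae {K : NNReal} {v : EuclideanSpace ℝ (Fin n) → ℝ}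
    (hv : LipschitzWith K v) : ∀ᵐ x, v x = 0 → gradient v x = 0 := by
  have habs : LipschitzWith K fun x => |v x| := by
    refine LipschitzWith.of_dist_le_mul fun x y => ?_
    exact (abs_abs_sub_abs_le_abs_sub _ _).trans (hv.dist_le_mul x y)
  filter_upwards [habs.ae_differentiableAt] with x hx h0
  have hmin : IsLocalMin (fun x => |v x|) x := by
    refine Eventually.of_forall fun y => ?_
    simp [h0]
  have h1 : HasFDerivAt (fun x => |v x|) (0 : EuclideanSpace ℝ (Fin n) →L[ℝ] ℝ) x := by
    have := hx.hasFDerivAt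
    rwa [hmin.fderiv_eq_zero] at this
  have h2 : HasFDerivAt v (0 : EuclideanSpace ℝ (Fin n) →L[ℝ] ℝ) x := by
    rw [hasFDerivAt_iff_isLittleO] at h1 ⊢
    simp only [h0, abs_zero, sub_zero, zero_apply] at h1 ⊢
    exact Asymptotics.isLittleO_abs_left.1 h1
  simp [gradient, h2.fderiv]

theorem norm_gradient_le {K : NNReal} {v : EuclideanSpace ℝ (Fin n) → ℝ}
    (hv : LipschitzWith K v) (x : EuclideanSpace ℝ (Fin n)) : ‖gradient v x‖ ≤ K := by
  rw [norm_gradient]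
  exact norm_fderiv_le_of_lipschitz ℝ hv

theorem integrable_gradient_of_lipschitz {K : NNReal} {v : EuclideanSpace ℝ (Fin n) → ℝ}
    (hv : LipschitzWith K v) (hc : HasCompactSupport v) : Integrable (gradient v) volume := by
  have hS : IsCompact (tsupport (gradient v)) := hasCompactSupport_gradient hc
  have h1 : IntegrableOn (gradient v) (tsupport (gradient v)) volume :=
    Measure.integrableOn_of_bounded hS.measure_lt_top.ne
      (measurable_gradient v).aestronglyMeasurable (M := K)
      (Eventually.of_forall fun x => norm_gradient_le hv x)
  exact (integrableOn_iff_integrable_of_support_subset (subset_tsupport _)).1 h1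

open scoped Convolution

/-- Putting the derivative on `v` instead of the mollifier bounds the gradients of the
mollifications by `K` and makes them converge almost everywhere. -/
theorem fderiv_normed_convolution {K : NNReal} {v : EuclideanSpace ℝ (Fin n) → ℝ}
    (hv : LipschitzWith K v) (φ : ContDiffBump (0 : EuclideanSpace ℝ (Fin n)))
    (x₀ : EuclideanSpace ℝ (Fin n)) :
    fderiv ℝ (φ.normed volume ⋆[ContinuousLinearMap.lsmul ℝ ℝ, volume] v) x₀ =
      (φ.normed volume ⋆[ContinuousLinearMap.lsmul ℝ ℝ, volume] fderiv ℝ v) x₀ := by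
  have hφc : Continuous (φ.normed volume) := φ.continuous_normed
  have hφi : Integrable (φ.normed volume) volume := φ.integrable_normed
  have hcont : ∀ x, Continuous fun t => φ.normed volume t • v (x - t) := fun x =>
    hφc.smul (hv.continuous.comp (by fun_prop))
  have key := hasFDerivAt_integral_of_dominated_loc_of_lip (𝕜 := ℝ) (μ := volume)
    (F := fun x t => φ.normed volume t • v (x - t))
    (F' := fun t => φ.normed volume t • fderiv ℝ v (x₀ - t)) (x₀ := x₀) (s := univ)
    (bound := fun t => φ.normed volume t * K) univ_mem
    (Eventually.of_forall fun x => (hcont x).aestronglyMeasurable)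
    ((hcont x₀).integrable_of_hasCompactSupport
      (φ.hasCompactSupport_normed.smul_right (f' := fun t => v (x₀ - t))))
    (hφc.measurable.smul ((measurable_fderiv ℝ v).comp
      (measurable_const.sub measurable_id))).aestronglyMeasurable
    (Eventually.of_forall fun t => by
      refine LipschitzOnWith.of_dist_le_mul fun x _ y _ => ?_
      rw [Real.coe_nnabs, abs_of_nonneg (mul_nonneg (φ.nonneg_normed t) K.coe_nonneg)]
      simp only [smul_eq_mul]
      rw [Real.dist_eq, ← mul_sub, abs_mul, abs_of_nonneg (φ.nonneg_normed t), mul_assoc]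
      refine mul_le_mul_of_nonneg_left ?_ (φ.nonneg_normed t)
      have := hv.dist_le_mul (x - t) (y - t)
      rwa [dist_sub_right, Real.dist_eq] at this)
    (hφi.mul_const _)
    (by
      have h1 := (quasiMeasurePreserving_sub_left volume x₀).ae hv.ae_differentiableAt
      filter_upwards [h1] with t ht
      have h2 : HasFDerivAt (fun x => v (x - t)) (fderiv ℝ v (x₀ - t)) x₀ :=
        (hasFDerivAt_comp_sub t).2 ht.hasFDerivAt
      exact h2.const_smul (φ.normed volume t))
  exact key.2.fderiv

/-- Integration by parts against compactly supported Lipschitz functions. -/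
theorem HasL2Divergence.integral_inner_gradient {U : Set (EuclideanSpace ℝ (Fin n))}
    (hU : IsOpen U) {z : EuclideanSpace ℝ (Fin n) → EuclideanSpace ℝ (Fin n)}
    {g : EuclideanSpace ℝ (Fin n) → ℝ} (hz : HasL2Divergence U z g) {K : NNReal}
    {v : EuclideanSpace ℝ (Fin n) → ℝ} (hv : LipschitzWith K v) (hc : HasCompactSupport v)
    (hvU : tsupport v ⊆ U) :
    ∫ x in U, inner ℝ (z x) (gradient v x) = -∫ x in U, g x * v x := by
  obtain ⟨δ, hδ, hδU⟩ := hc.isCompact.exists_cthickening_subset_open hU hvU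
  set S := Metric.cthickening δ (tsupport v) with hS
  have hSc : IsCompact S := hc.isCompact.cthickening
  -- The fixed ratio `rOut = 2 * rIn` is what almost everywhere convergence of the mollified
  -- derivative requires; `rOut ≤ δ` keeps all supports in `S`.
  let φ : ℕ → ContDiffBump (0 : EuclideanSpace ℝ (Fin n)) := fun k =>
    { rIn := δ / 2 * (1 / ((k : ℝ) + 1))
      rOut := δ * (1 / ((k : ℝ) + 1))
      rIn_pos := by positivity
      rIn_lt_rOut := by
        have : 0 < 1 / ((k : ℝ) + 1) := by positivity
        nlinarith }
  have hrOut : ∀ k, (φ k).rOut ≤ δ := fun k => by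
    have : 1 / ((k : ℝ) + 1) ≤ 1 := by
      rw [div_le_one (by positivity)]
      have : (0 : ℝ) ≤ k := k.cast_nonneg
      linarith
    exact mul_le_of_le_one_right hδ.le this
  have hlim : Tendsto (fun k => (φ k).rOut) atTop (𝓝 0) := by
    have := (tendsto_one_div_add_atTop_nhds_zero_nat (𝕜 := ℝ)).const_mul δ
    rwa [mul_zero] at this
  set w : ℕ → EuclideanSpace ℝ (Fin n) → ℝ := fun k =>
    (φ k).normed volume ⋆[ContinuousLinearMap.lsmul ℝ ℝ, volume] v with hw
  have hwsupp : ∀ k, tsupport (w k) ⊆ S := by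
    intro k
    refine closure_minimal ?_ Metric.isClosed_cthickening
    refine (support_convolution_subset _).trans ?_
    rintro _ ⟨a, ha, b, hb, rfl⟩
    rw [(φ k).support_normed_eq] at ha
    refine Metric.mem_cthickening_of_dist_le _ b δ _ (subset_tsupport _ hb) ?_
    simp only [dist_eq_norm, add_sub_cancel_right]
    rw [mem_ball_zero_iff] at ha
    exact ha.le.trans (hrOut k)
  have hwtest : ∀ k, w k ∈ testFunctions U := fun k =>
    ⟨(φ k).hasCompactSupport_normed.contDiff_convolution_left _ (φ k).contDiff_normed
      hv.continuous.locallyIntegrable,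
      HasCompactSupport.convolution _ (φ k).hasCompactSupport_normed hc,
      (hwsupp k).trans hδU⟩
  have hvi : LocallyIntegrable (fderiv ℝ v) volume := by
    refine (locallyIntegrable_const (K : ℝ)).mono (measurable_fderiv ℝ v).aestronglyMeasurable
      (Eventually.of_forall fun x => ?_)
    rw [Real.norm_of_nonneg K.coe_nonneg]
    exact norm_fderiv_le_of_lipschitz ℝ hv
  have hgradlim : ∀ᵐ x, Tendsto (fun k => gradient (w k) x) atTop (𝓝 (gradient v x)) := by
    filter_upwards [ContDiffBump.ae_convolution_tendsto_right_of_locallyIntegrable (φ := φ)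
      (l := atTop) (K := 2) hlim (Eventually.of_forall fun k => by
        change δ * _ ≤ 2 * (δ / 2 * _); linarith) hvi] with x hx
    refine ((InnerProductSpace.toDual ℝ (EuclideanSpace ℝ (Fin n))).symm.continuous.tendsto
      _).comp (hx.congr fun k => ?_)
    exact (fderiv_normed_convolution hv (φ k) x).symm
  have hgradbd : ∀ k x, ‖gradient (w k) x‖ ≤ K := by
    intro k x
    rw [norm_gradient, hw, fderiv_normed_convolution hv (φ k) x]
    calc _ ≤ ∫ t, (φ k).normed volume t * K := by
          refine norm_integral_le_of_norm_le ((φ k).integrable_normed.mul_const _)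
            (Eventually.of_forall fun t => ?_)
          rw [ContinuousLinearMap.lsmul_apply, norm_smul,
            Real.norm_of_nonneg ((φ k).nonneg_normed t)]
          gcongr
          · exact (φ k).nonneg_normed t
          · exact norm_fderiv_le_of_lipschitz ℝ hv
      _ = K := by rw [integral_mul_const, (φ k).integral_normed, one_mul]
  have hwlim : ∀ x, Tendsto (fun k => w k x) atTop (𝓝 (v x)) := fun x =>
    ContDiffBump.convolution_tendsto_right_of_continuous hlim hv.continuous x
  have hwbd : ∀ k x, |w k x| ≤ |v x| + K * δ := by
    intro k x
    have h1 := (φ k).dist_normed_convolution_le (x₀ := x) (g := v) (ε := K * δ)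
      (μ := volume) hv.continuous.aestronglyMeasurable (fun y hy => by
        refine (hv.dist_le_mul y x).trans ?_
        gcongr
        exact (Metric.mem_ball.1 hy).le.trans (hrOut k))
    rw [Real.dist_eq] at h1
    have h2 := abs_sub_abs_le_abs_sub (w k x) (v x)
    linarith
  have hzero : ∀ k x, x ∉ S → w k x = 0 ∧ gradient (w k) x = 0 := by
    intro k x hx
    refine ⟨image_eq_zero_of_notMem_tsupport fun h => hx (hwsupp k h), ?_⟩
    have : w k =ᶠ[𝓝 x] fun _ => 0 :=
      notMem_tsupport_iff_eventuallyEq.1 fun h => hx (hwsupp k h)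
    rw [this.gradient_eq]
    exact gradient_const x 0
  obtain ⟨M, hM⟩ : ∃ M, ∀ᵐ x ∂volume.restrict U, ‖z x‖ ≤ M := by
    obtain ⟨M, hM⟩ := (eLpNormEssSup_lt_top_iff_isBoundedUnder.1 (by
      simpa using hz.field_memLp.2))
    exact ⟨M, hM⟩
  have hSfin : (volume.restrict U) S ≠ ⊤ :=
    ((Measure.restrict_apply_le _ _).trans_lt hSc.measure_lt_top).ne
  obtain ⟨B, hB⟩ := hc.exists_bound_of_continuous hv.continuous
  have lim1 : Tendsto (fun k => ∫ x in U, inner ℝ (z x) (gradient (w k) x)) atTop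
      (𝓝 (∫ x in U, inner ℝ (z x) (gradient v x))) := by
    refine tendsto_integral_of_dominated_convergence (S.indicator fun _ => M * K)
      (fun k => hz.field_memLp.1.inner (testFunctions.integrable_gradient (hwtest k)).1)
      ((integrable_indicator_iff hSc.measurableSet).2 (integrableOn_const hSfin)) (fun k => ?_) ?_
    · filter_upwards [hM] with x hx
      by_cases hxS : x ∈ S
      · rw [indicator_of_mem hxS]
        refine (norm_inner_le_norm _ _).trans ?_
        exact mul_le_mul hx (hgradbd k x) (norm_nonneg _) ((norm_nonneg _).trans hx)
      · rw [indicator_of_notMem hxS, (hzero k x hxS).2, inner_zero_right, norm_zero]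
    · filter_upwards [ae_restrict_of_ae hgradlim] with x hx
      exact tendsto_const_nhds.inner hx
  have hgS : IntegrableOn g S (volume.restrict U) := by
    have : IsFiniteMeasure ((volume.restrict U).restrict S) :=
      ⟨by rw [Measure.restrict_apply_univ]; exact hSfin.lt_top⟩
    exact (hz.div_memLp.restrict S).integrable one_le_two
  have lim2 : Tendsto (fun k => ∫ x in U, g x * w k x) atTop (𝓝 (∫ x in U, g x * v x)) := by
    refine tendsto_integral_of_dominated_convergence (S.indicator fun x => ‖g x‖ * (B + K * δ))
      (fun k => hz.div_memLp.1.mul (testFunctions.memLp (hwtest k)).1)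
      ((integrable_indicator_iff hSc.measurableSet).2 (hgS.norm.mul_const _))
      (fun k => Eventually.of_forall fun x => ?_) (Eventually.of_forall fun x => ?_)
    · by_cases hxS : x ∈ S
      · rw [indicator_of_mem hxS, norm_mul]
        gcongr
        have h1 := hwbd k x
        have h2 := hB x
        rw [Real.norm_eq_abs] at h2 ⊢
        linarith
      · rw [indicator_of_notMem hxS, (hzero k x hxS).1, mul_zero, norm_zero]
    · exact (hwlim x).const_mul _
  refine tendsto_nhds_unique lim1 (lim2.neg.congr fun k => ?_)
  exact (hz.div_eq (w k) (hwtest k).1 (hwtest k).2.1 (hwtest k).2.2).symm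

end Lipschitz

/-! ### Changes of levels on the positive half-line. -/

section Profile

/-- `θ` is a `C¹` function with derivative in `[0, 1]`, which vanishes on the negative half-line
and strictly increases on the positive one. -/
structure IsProfile (θ m : ℝ → ℝ) : Prop where
  cont : Continuous m
  hasDerivAt : ∀ t, HasDerivAt θ (m t) t
  nonneg : ∀ t, 0 ≤ m t
  le_one : ∀ t, m t ≤ 1
  pos : ∀ t, 0 < t → 0 < m t
  zero : ∀ t, t ≤ 0 → m t = 0
  map_zero : θ 0 = 0

namespace IsProfile

variable {θ m : ℝ → ℝ} (h : IsProfile θ m)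
include h

theorem monotone : Monotone θ :=
  monotone_of_deriv_nonneg (fun t => (h.hasDerivAt t).differentiableAt) fun t => by
    rw [(h.hasDerivAt t).deriv]; exact h.nonneg t

theorem continuous : Continuous θ :=
  continuous_iff_continuousAt.2 fun t => (h.hasDerivAt t).continuousAt

theorem eq_zero {t : ℝ} (ht : t ≤ 0) : θ t = 0 := by
  have h1 : ∫ s in t..0, m s = θ 0 - θ t :=
    intervalIntegral.integral_eq_sub_of_hasDerivAt (fun s _ => h.hasDerivAt s)
      (h.cont.intervalIntegrable _ _)
  have h2 : ∫ s in t..0, m s = ∫ s in t..0, (0 : ℝ) := by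
    refine intervalIntegral.integral_congr fun s hs => ?_
    rw [uIcc_of_le ht] at hs
    exact h.zero s hs.2
  rw [h2, h.map_zero] at h1
  simp at h1
  exact h1

theorem pos_of_pos {t : ℝ} (ht : 0 < t) : 0 < θ t := by
  have h1 : ∫ s in (0 : ℝ)..t, m s = θ t - θ 0 :=
    intervalIntegral.integral_eq_sub_of_hasDerivAt (fun s _ => h.hasDerivAt s)
      (h.cont.intervalIntegrable _ _)
  have h2 := intervalIntegral.intervalIntegral_pos_of_pos_on (h.cont.intervalIntegrable 0 t)
    (fun s hs => h.pos s hs.1) ht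
  rw [h1, h.map_zero] at h2
  linarith

theorem nonneg' (t : ℝ) : 0 ≤ θ t := by
  rcases le_or_gt t 0 with ht | ht
  · exact (h.eq_zero ht).ge
  · exact (h.pos_of_pos ht).le

end IsProfile

theorem isProfile_of_density {m : ℝ → ℝ} (hc : Continuous m) (h0 : ∀ t, 0 ≤ m t)
    (h1 : ∀ t, m t ≤ 1) (hp : ∀ t, 0 < t → 0 < m t) (hz : ∀ t, t ≤ 0 → m t = 0) :
    IsProfile (fun t => ∫ s in (0 : ℝ)..t, m s) m :=
  ⟨hc, fun t => (hc.integral_hasStrictDerivAt 0 t).hasDerivAt, h0, h1, hp, hz, by simp⟩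

theorem exists_isProfile : ∃ θ m, IsProfile θ m := by
  refine ⟨_, _, isProfile_of_density (m := fun s => min 1 (max 0 s)) (by fun_prop)
    (fun t => by positivity) (fun t => min_le_left _ _) (fun t ht => ?_) (fun t ht => ?_)⟩
  · exact lt_min one_pos (lt_max_of_lt_right ht)
  · rw [max_eq_left ht]; simp

/-- A function positive where `u` is can be reached from `u` by a change of levels. -/
theorem exists_isProfile_lt {Y : Type*} [TopologicalSpace Y] {N : Set Y} (hN : IsCompact N)
    {u v : Y → ℝ} (hu : Continuous u) (hv : Continuous v) (huv : ∀ x ∈ N, 0 < u x → 0 < v x) :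
    ∃ θ m, IsProfile θ m ∧ ∀ x ∈ N, 0 < v x → θ (u x) < v x := by
  rcases N.eq_empty_or_nonempty with rfl | hne
  · obtain ⟨θ, m, h⟩ := exists_isProfile
    exact ⟨θ, m, h, fun x hx => hx.elim⟩
  obtain ⟨B, hB⟩ := (hN.bddAbove_image hu.continuousOn)
  set b := max B 1 with hb
  have hb1 : 1 ≤ b := le_max_right _ _
  -- The minimum of `F s` over `N` is nondecreasing in `s`, positive for `s > 0` because `v > 0`
  -- wherever `u > 0`, and at `s = u x` at most `v x` when `v x > 0`.
  set F : ℝ → Y → ℝ := fun s x => max (v x) 0 + max (s - u x) 0 with hF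
  have hF0 : ∀ s x, 0 ≤ F s x := fun s x => by positivity
  set m₀ : ℝ → ℝ := fun s => sInf (F s '' N) with hm₀
  have hm₀c : Continuous m₀ := hN.continuous_sInf (f := F) (by
    simp only [hF, Function.HasUncurry.uncurry, id]
    fun_prop)
  have hm₀le : ∀ s, ∀ x ∈ N, m₀ s ≤ F s x := fun s x hx =>
    csInf_le ⟨0, by rintro _ ⟨y, _, rfl⟩; exact hF0 s y⟩ ⟨x, hx, rfl⟩
  have hm₀mono : Monotone m₀ := fun s t hst => by
    refine le_csInf (hne.image _) ?_
    rintro _ ⟨x, hx, rfl⟩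
    refine (hm₀le s x hx).trans ?_
    simp only [hF]
    gcongr
  have hm₀0 : ∀ s, 0 ≤ m₀ s := fun s => by
    refine le_csInf (hne.image _) ?_
    rintro _ ⟨x, hx, rfl⟩
    exact hF0 s x
  have hm₀pos : ∀ s, 0 < s → 0 < m₀ s := fun s hs => by
    obtain ⟨x, hx, hxe⟩ := hN.exists_sInf_image_eq hne (f := F s)
      (by simp only [hF]; fun_prop)
    change 0 < sInf (F s '' N)
    rw [hxe]
    simp only [hF]
    rcases lt_or_ge 0 (v x) with hvx | hvx
    · exact add_pos_of_pos_of_nonneg (lt_max_of_lt_left hvx) (le_max_right _ _)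
    · have : u x ≤ 0 := not_lt.1 fun h => hvx.not_gt (huv x hx h)
      exact add_pos_of_nonneg_of_pos (le_max_right _ _) (lt_max_of_lt_left (by linarith))
  -- The inner truncation makes the density vanish for `s ≤ 0` and stay below `1`. As `u ≤ b` on
  -- `N`, the divisor `2 * b` gives `θ (u x) ≤ v x / 2`, hence strict inequality.
  set m : ℝ → ℝ := fun s => min (min 1 (max 0 s)) (m₀ s) / (2 * b) with hm
  have hmc : Continuous m := by fun_prop
  have hp : IsProfile (fun t => ∫ s in (0 : ℝ)..t, m s) m := by
    refine isProfile_of_density hmc (fun t => ?_) (fun t => ?_) (fun t ht => ?_) (fun t ht => ?_)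
    · have := hm₀0 t
      simp only [hm]
      positivity
    · simp only [hm]
      rw [div_le_one (by positivity)]
      exact ((min_le_left _ _).trans (min_le_left _ _)).trans (by linarith)
    · exact div_pos (lt_min (lt_min one_pos (lt_max_of_lt_right ht)) (hm₀pos t ht))
        (by positivity)
    · simp only [hm]
      rw [max_eq_left ht, min_eq_right zero_le_one, min_eq_left (hm₀0 t), zero_div]
  refine ⟨_, m, hp, fun x hx hvx => ?_⟩
  rcases le_or_gt (u x) 0 with hux | hux
  · exact (hp.eq_zero hux).trans_lt hvx
  · have h1 : ∫ s in (0 : ℝ)..u x, m s ≤ ∫ _ in (0 : ℝ)..u x, m₀ (u x) / (2 * b) := by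
      refine intervalIntegral.integral_mono_on hux.le (hmc.intervalIntegrable _ _)
        intervalIntegrable_const fun s hs => ?_
      simp only [hm]
      gcongr
      exact (min_le_right _ _).trans (hm₀mono hs.2)
    rw [intervalIntegral.integral_const, sub_zero, smul_eq_mul] at h1
    have h2 : m₀ (u x) ≤ v x := by
      have := hm₀le (u x) x hx
      simpa [hF, hvx.le] using this
    have h3 : u x ≤ b := (hB ⟨x, hx, rfl⟩).trans (le_max_left _ _)
    have h4 : u x * (m₀ (u x) / (2 * b)) ≤ b * (v x / (2 * b)) := by
      gcongr
      exact div_nonneg (hm₀0 _) (by positivity)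
    have h5 : b * (v x / (2 * b)) = v x / 2 := by field_simp
    linarith

end Profile

/-! ### Relevelling `ψ₁` and `ψ₂` into ordered functions. -/

section Relevel

variable {n : ℕ}

/-- `φ` is a Lipschitz function whose gradient is a.e. a positive multiple of that of `ψ`. -/
structure IsRelevelling (ψ φ : EuclideanSpace ℝ (Fin n) → ℝ) : Prop where
  lipschitz : ∃ K, LipschitzWith K φ
  gradient_eq : ∀ᵐ x, ∃ c : ℝ, 0 < c ∧ gradient φ x = c • gradient ψ x

theorem isRelevelling_comp {K : NNReal} {ψ : EuclideanSpace ℝ (Fin n) → ℝ}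
    (hψ : LipschitzWith K ψ) {Θ m : ℝ → ℝ} (hΘ : ∀ t, HasDerivAt Θ (m t) t) {L : NNReal}
    (hm0 : ∀ t, t ≠ 0 → 0 < m t) (hmL : ∀ t, ‖m t‖₊ ≤ L) : IsRelevelling ψ (Θ ∘ ψ) := by
  refine ⟨⟨L * K, ?_⟩, ?_⟩
  · refine LipschitzWith.comp (lipschitzWith_of_nnnorm_deriv_le
      (fun t => (hΘ t).differentiableAt) fun t => ?_) hψ
    rw [(hΘ t).deriv]
    exact hmL t
  · filter_upwards [hψ.ae_differentiableAt, gradient_eq_zero_of_zero_ae hψ] with x hx hx0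
    have h1 : gradient (Θ ∘ ψ) x = m (ψ x) • gradient ψ x := by
      have := (hΘ (ψ x)).comp_hasFDerivAt x hx.hasFDerivAt
      simp [gradient, this.fderiv]
    -- The factor `m` may vanish at level `0`, but there `∇ψ = 0` almost everywhere and any positive
    -- factor serves.
    rcases eq_or_ne (ψ x) 0 with h0 | h0
    · exact ⟨1, one_pos, by rw [h1, hx0 h0]; simp⟩
    · exact ⟨m (ψ x), hm0 _ h0, h1⟩

/-- Functions with ordered signs have ordered relevellings near a compact set. -/
theorem exists_relevellings {N : Set (EuclideanSpace ℝ (Fin n))} (hN : IsCompact N)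
    {K₁ K₂ : NNReal} {ψ₁ ψ₂ : EuclideanSpace ℝ (Fin n) → ℝ} (h₁ : LipschitzWith K₁ ψ₁)
    (h₂ : LipschitzWith K₂ ψ₂) (hsign : ∀ x ∈ N, Real.sign (ψ₁ x) ≤ Real.sign (ψ₂ x)) :
    ∃ φ₁ φ₂, IsRelevelling ψ₁ φ₁ ∧ IsRelevelling ψ₂ φ₂ ∧
      (∀ x, ψ₁ x = 0 → ψ₂ x = 0 → φ₁ x = φ₂ x) ∧
      (∀ x ∈ N, ¬(ψ₁ x = 0 ∧ ψ₂ x = 0) → φ₁ x < φ₂ x) := by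
  have hpos : ∀ x ∈ N, 0 < ψ₁ x → 0 < ψ₂ x := by
    intro x hx h
    have h3 := hsign x hx
    rw [Real.sign_of_pos h] at h3
    rcases lt_trichotomy (ψ₂ x) 0 with h4 | h4 | h4
    · rw [Real.sign_of_neg h4] at h3; norm_num at h3
    · rw [h4, Real.sign_zero] at h3; norm_num at h3
    · exact h4
  have hneg : ∀ x ∈ N, ψ₂ x < 0 → ψ₁ x < 0 := by
    intro x hx h
    have h3 := hsign x hx
    rw [Real.sign_of_neg h] at h3
    rcases lt_trichotomy (ψ₁ x) 0 with h4 | h4 | h4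
    · exact h4
    · rw [h4, Real.sign_zero] at h3; norm_num at h3
    · rw [Real.sign_of_pos h4] at h3; norm_num at h3
  obtain ⟨q, e, hq⟩ := exists_isProfile
  have hqpos : ∀ t, 0 < q t ↔ 0 < t := fun t =>
    ⟨fun h => not_le.1 fun ht => h.ne' (hq.eq_zero ht), hq.pos_of_pos⟩
  obtain ⟨α, a, hα, hα'⟩ := exists_isProfile_lt hN (u := ψ₁) (v := fun x => q (ψ₂ x))
    h₁.continuous (hq.continuous.comp h₂.continuous)
    (fun x hx h => (hqpos _).2 (hpos x hx h))
  obtain ⟨β, b, hβ, hβ'⟩ := exists_isProfile_lt hN (u := fun x => -ψ₂ x)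
    (v := fun x => q (-ψ₁ x)) h₂.continuous.neg (hq.continuous.comp h₁.continuous.neg)
    (fun x hx h => (hqpos _).2 (by have := hneg x hx (by linarith); linarith))
  have hreflect : ∀ {θ m : ℝ → ℝ}, IsProfile θ m → ∀ t, HasDerivAt (fun s => θ (-s)) (-m (-t)) t :=
    fun {θ m} h t => by
    have := HasDerivAt.scomp t (h.hasDerivAt (-t)) (hasDerivAt_neg t)
    rw [neg_one_smul] at this
    exact this
  have hbd : ∀ {m m' θ θ' : ℝ → ℝ}, IsProfile θ m → IsProfile θ' m' → ∀ t : ℝ,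
      (t ≠ 0 → 0 < m t + m' (-t)) ∧ ‖m t + m' (-t)‖₊ ≤ 2 := by
    intro m m' θ θ' h h' t
    refine ⟨fun ht => ?_, ?_⟩
    · rcases ht.lt_or_gt with ht | ht
      · exact add_pos_of_nonneg_of_pos (h.nonneg _) (h'.pos _ (by linarith))
      · exact add_pos_of_pos_of_nonneg (h.pos _ ht) (h'.nonneg _)
    · rw [← NNReal.coe_le_coe, coe_nnnorm,
        Real.norm_of_nonneg (add_nonneg (h.nonneg _) (h'.nonneg _))]
      have := h.le_one t
      have := h'.le_one (-t)
      norm_num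
      linarith
  -- The difference `φ₂ - φ₁` splits into `q(ψ₂) - α(ψ₁)` and `q(-ψ₁) - β(-ψ₂)`. On `N` both are
  -- nonnegative, the first positive where `ψ₂ > 0`, the second where `ψ₁ < 0`; by the sign
  -- condition only common zeros escape both cases.
  refine ⟨(fun t => α t - q (-t)) ∘ ψ₁, (fun t => q t - β (-t)) ∘ ψ₂,
    isRelevelling_comp h₁ (m := fun t => a t + e (-t)) (L := 2) (fun t => ?_)
      (fun t => (hbd hα hq t).1) (fun t => (hbd hα hq t).2),
    isRelevelling_comp h₂ (m := fun t => e t + b (-t)) (L := 2) (fun t => ?_)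
      (fun t => (hbd hq hβ t).1) (fun t => (hbd hq hβ t).2), fun x hx1 hx2 => ?_,
      fun x hx hne => ?_⟩
  · have := (hα.hasDerivAt t).sub (hreflect hq t)
    rw [sub_neg_eq_add] at this
    exact this
  · have := (hq.hasDerivAt t).sub (hreflect hβ t)
    rw [sub_neg_eq_add] at this
    exact this
  · simp [hx1, hx2, hα.map_zero, hq.map_zero, hβ.map_zero]
  · simp only [Function.comp]
    have hA : α (ψ₁ x) ≤ q (ψ₂ x) := by
      rcases lt_or_ge 0 (ψ₂ x) with h | h
      · exact (hα' x hx ((hqpos _).2 h)).le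
      · have : ψ₁ x ≤ 0 := not_lt.1 fun h' => h.not_gt (hpos x hx h')
        rw [hα.eq_zero this]
        exact hq.nonneg' _
    have hB : β (-ψ₂ x) ≤ q (-ψ₁ x) := by
      rcases lt_or_ge 0 (-ψ₁ x) with h | h
      · exact (hβ' x hx ((hqpos _).2 h)).le
      · have : -ψ₂ x ≤ 0 := not_lt.1 fun h' => by
          have := hneg x hx (by linarith)
          linarith
        rw [hβ.eq_zero this]
        exact hq.nonneg' _
    rcases lt_or_ge 0 (ψ₂ x) with h | h
    · have := hα' x hx ((hqpos _).2 h)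
      linarith
    · rcases lt_or_ge 0 (-ψ₁ x) with h' | h'
      · have := hβ' x hx ((hqpos _).2 h')
        linarith
      · exfalso
        have h3 : ψ₁ x ≤ 0 := not_lt.1 fun h'' => h.not_gt (hpos x hx h'')
        have h4 : 0 ≤ ψ₂ x := not_lt.1 fun h'' => by
          have := hneg x hx h''
          linarith
        exact hne ⟨le_antisymm h3 (by linarith), le_antisymm h h4⟩

theorem IsRelevelling.dirDeriv_eq {ψ φ : EuclideanSpace ℝ (Fin n) → ℝ} (h : IsRelevelling ψ φ)
    {σ : EuclideanSpace ℝ (Fin n) → ℝ} {C : ℝ} (hσ : IsBoundedSublinear σ C) :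
    ∀ᵐ x, ∀ q, dirDeriv σ (gradient φ x) q = dirDeriv σ (gradient ψ x) q := by
  filter_upwards [h.gradient_eq] with x ⟨c, hc, hx⟩ q
  rw [hx, hσ.dirDeriv_smul_left _ _ hc]

end Relevel

/-! ### The min–max exchange near the common zero set. -/

section Swap

variable {n : ℕ}

/-- The part of `w₁ - w₂ - M (φ₂ - φ₁)` which is positive and near `D`. -/
noncomputable def overlap (D : Set (EuclideanSpace ℝ (Fin n))) (δ κ : ℝ)
    (w₁ w₂ φ₁ φ₂ : EuclideanSpace ℝ (Fin n) → ℝ) (M : ℝ) (x : EuclideanSpace ℝ (Fin n)) : ℝ :=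
  min (max (w₁ x - w₂ x - M * (φ₂ x - φ₁ x)) 0) (κ * max (2 * δ - Metric.infDist x D) 0)

variable {D : Set (EuclideanSpace ℝ (Fin n))} {δ κ B : ℝ}
  {w₁ w₂ φ₁ φ₂ : EuclideanSpace ℝ (Fin n) → ℝ} {M : ℝ}

theorem exists_lipschitzWith_overlap
    (hw₁ : ∃ K, LipschitzWith K w₁) (hw₂ : ∃ K, LipschitzWith K w₂)
    (hφ₁ : ∃ K, LipschitzWith K φ₁) (hφ₂ : ∃ K, LipschitzWith K φ₂) :
    ∃ K, LipschitzWith K (overlap D δ κ w₁ w₂ φ₁ φ₂ M) := by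
  obtain ⟨K₁, h₁⟩ := hw₁
  obtain ⟨K₂, h₂⟩ := hw₂
  obtain ⟨L₁, l₁⟩ := hφ₁
  obtain ⟨L₂, l₂⟩ := hφ₂
  have hlin : ∀ c : ℝ, LipschitzWith ‖c‖₊ fun x : ℝ => c * x := fun c => lipschitzWith_smul c
  have hD := Metric.lipschitz_infDist_pt D
  exact ⟨_, (((h₁.sub h₂).sub ((hlin M).comp (l₂.sub l₁))).max_const 0).min
    ((hlin κ).comp ((((LipschitzWith.const (2 * δ)).sub hD)).max_const 0))⟩

theorem overlap_nonneg (hκ : 0 ≤ κ) (x : EuclideanSpace ℝ (Fin n)) :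
    0 ≤ overlap D δ κ w₁ w₂ φ₁ φ₂ M x :=
  le_min (le_max_right _ _) (mul_nonneg hκ (le_max_right _ _))

theorem overlap_eq_zero_of_far {x : EuclideanSpace ℝ (Fin n)} (hx : 2 * δ ≤ Metric.infDist x D) :
    overlap D δ κ w₁ w₂ φ₁ φ₂ M x = 0 := by
  unfold overlap
  rw [max_eq_right (by linarith : 2 * δ - Metric.infDist x D ≤ 0), mul_zero]
  exact min_eq_right (le_max_right _ _)

theorem overlap_le (hB : ∀ x, w₁ x - w₂ x ≤ B) (hB0 : 0 ≤ B) (hM : 0 ≤ M)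
    (hφ : ∀ x, Metric.infDist x D ≤ 2 * δ → φ₁ x ≤ φ₂ x) (x : EuclideanSpace ℝ (Fin n)) :
    overlap D δ κ w₁ w₂ φ₁ φ₂ M x ≤ B := by
  rcases le_or_gt (2 * δ) (Metric.infDist x D) with hx | hx
  · rw [overlap_eq_zero_of_far hx]; exact hB0
  · refine (min_le_left _ _).trans (max_le ?_ hB0)
    have := mul_nonneg hM (sub_nonneg.2 (hφ x hx.le))
    linarith [hB x]

theorem overlap_eq_of_near (hδ : 0 < δ) (hκ : κ * δ = B) (hκ0 : 0 ≤ κ)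
    (hB : ∀ x, w₁ x - w₂ x ≤ B) (hB0 : 0 ≤ B) (hM : 0 ≤ M)
    (hφ : ∀ x, Metric.infDist x D ≤ 2 * δ → φ₁ x ≤ φ₂ x) {x : EuclideanSpace ℝ (Fin n)}
    (hx : Metric.infDist x D ≤ δ) :
    overlap D δ κ w₁ w₂ φ₁ φ₂ M x = max (w₁ x - w₂ x - M * (φ₂ x - φ₁ x)) 0 := by
  refine min_eq_left ?_
  have h1 := mul_nonneg hM (sub_nonneg.2 (hφ x (by linarith)))
  have h2 : B ≤ κ * max (2 * δ - Metric.infDist x D) 0 := by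
    rw [← hκ]
    gcongr
    exact le_max_of_le_left (by linarith)
  exact (max_le (by linarith [hB x]) hB0).trans h2

/-- For large `M` the overlap lives near `D`. -/
theorem overlap_eq_zero_of_le {c : ℝ} (hB : ∀ x, w₁ x - w₂ x ≤ B) (hM : 0 ≤ M) (hMc : B ≤ M * c)
    (hκ0 : 0 ≤ κ) {x : EuclideanSpace ℝ (Fin n)} (hx : c ≤ φ₂ x - φ₁ x) :
    overlap D δ κ w₁ w₂ φ₁ φ₂ M x = 0 := by
  refine le_antisymm ((min_le_left _ _).trans (max_le ?_ le_rfl)) (overlap_nonneg hκ0 x)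
  have : M * c ≤ M * (φ₂ x - φ₁ x) := by gcongr
  linarith [hB x]

theorem infDist_lt_of_overlap_pos {c : ℝ} (hB : ∀ x, w₁ x - w₂ x ≤ B) (hM : 0 ≤ M)
    (hMc : B ≤ M * c) (hκ0 : 0 ≤ κ)
    (hc : ∀ x, Metric.infDist x D ≤ 2 * δ → δ ≤ Metric.infDist x D → c ≤ φ₂ x - φ₁ x)
    {x : EuclideanSpace ℝ (Fin n)} (hx : 0 < overlap D δ κ w₁ w₂ φ₁ φ₂ M x) :
    Metric.infDist x D < δ := by
  by_contra h
  push Not at h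
  rcases le_or_gt (2 * δ) (Metric.infDist x D) with h2 | h2
  · rw [overlap_eq_zero_of_far h2] at hx; exact hx.false
  · rw [overlap_eq_zero_of_le hB hM hMc hκ0 (hc x h2.le h)] at hx; exact hx.false

theorem gradient_sub' {v w : EuclideanSpace ℝ (Fin n) → ℝ} {x : EuclideanSpace ℝ (Fin n)}
    (hv : DifferentiableAt ℝ v x) (hw : DifferentiableAt ℝ w x) :
    gradient (v - w) x = gradient v x - gradient w x := by
  simp [gradient, fderiv_sub hv hw]

/-- Positivity of the overlap is an open condition and confines it to distance less than `δ` from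
`D`, where the cap is inactive. Locally it is therefore the plain difference. -/
theorem gradient_overlap {c : ℝ} (hδ : 0 < δ) (hκ : κ * δ = B) (hκ0 : 0 ≤ κ)
    (hB : ∀ x, w₁ x - w₂ x ≤ B) (hB0 : 0 ≤ B) (hM : 0 ≤ M) (hMc : B ≤ M * c)
    (hφ : ∀ x, Metric.infDist x D ≤ 2 * δ → φ₁ x ≤ φ₂ x)
    (hc : ∀ x, Metric.infDist x D ≤ 2 * δ → δ ≤ Metric.infDist x D → c ≤ φ₂ x - φ₁ x)
    (hcont : Continuous (overlap D δ κ w₁ w₂ φ₁ φ₂ M)) {x : EuclideanSpace ℝ (Fin n)}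
    (d₁ : DifferentiableAt ℝ w₁ x) (d₂ : DifferentiableAt ℝ w₂ x)
    (e₁ : DifferentiableAt ℝ φ₁ x) (e₂ : DifferentiableAt ℝ φ₂ x)
    (hx : 0 < overlap D δ κ w₁ w₂ φ₁ φ₂ M x) :
    gradient (overlap D δ κ w₁ w₂ φ₁ φ₂ M) x =
      gradient w₁ x - gradient w₂ x - M • (gradient φ₂ x - gradient φ₁ x) := by
  have hev : overlap D δ κ w₁ w₂ φ₁ φ₂ M =ᶠ[𝓝 x] (w₁ - w₂) - M • (φ₂ - φ₁) := by
    have hpos : ∀ᶠ y in 𝓝 x, 0 < overlap D δ κ w₁ w₂ φ₁ φ₂ M y :=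
      hcont.continuousAt.eventually_const_lt hx
    filter_upwards [hpos] with y hy
    have hyD := infDist_lt_of_overlap_pos hB hM hMc hκ0 hc hy
    rw [overlap_eq_of_near hδ hκ hκ0 hB hB0 hM hφ hyD.le] at hy ⊢
    rw [max_eq_left ((lt_max_iff.1 hy).resolve_right (lt_irrefl 0)).le]
    simp
  rw [hev.gradient_eq, gradient_sub' (d₁.sub d₂) ((e₂.sub e₁).const_smul M),
    gradient_sub' d₁ d₂, gradient_smul' M (e₂.sub e₁), gradient_sub' e₂ e₁]

variable {U : Set (EuclideanSpace ℝ (Fin n))} {σ : EuclideanSpace ℝ (Fin n) → ℝ} {C : ℝ}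

/-- Exchanging `w₁` and `w₂` on an overlap does not increase the total difference quotient. -/
theorem dirDeriv_swap_le (h : IsBoundedSublinear σ C) {p₁ p₂ q₁ q₂ r : EuclideanSpace ℝ (Fin n)}
    (hM : 0 < M) (hr : r = 0 ∨ r = q₁ - q₂ - M • (p₂ - p₁)) :
    dirDeriv σ p₁ (q₁ - r) + dirDeriv σ p₂ (q₂ + r) ≤
      diffQuot σ p₁ q₁ M⁻¹ + diffQuot σ p₂ q₂ M⁻¹ := by
  have hM' : 0 < M⁻¹ := inv_pos.2 hM
  rcases hr with rfl | rfl
  · rw [sub_zero, add_zero]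
    exact add_le_add (h.dirDeriv_le_diffQuot _ _ hM') (h.dirDeriv_le_diffQuot _ _ hM')
  · refine (add_le_add (h.dirDeriv_le_diffQuot _ _ hM') (h.dirDeriv_le_diffQuot _ _ hM')).trans_eq
      ?_
    -- With the second choice of `r` the vectors `p₁ + q₁/M` and `p₂ + q₂/M` trade places, so the
    -- sum of quotients is unchanged.
    have h1 : p₁ + M⁻¹ • (q₁ - (q₁ - q₂ - M • (p₂ - p₁))) = p₂ + M⁻¹ • q₂ := by
      rw [show q₁ - (q₁ - q₂ - M • (p₂ - p₁)) = q₂ + M • (p₂ - p₁) by abel, smul_add, smul_smul,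
        inv_mul_cancel₀ hM.ne', one_smul]
      abel
    have h2 : p₂ + M⁻¹ • (q₂ + (q₁ - q₂ - M • (p₂ - p₁))) = p₁ + M⁻¹ • q₁ := by
      rw [show q₂ + (q₁ - q₂ - M • (p₂ - p₁)) = q₁ - M • (p₂ - p₁) by abel, smul_sub, smul_smul,
        inv_mul_cancel₀ hM.ne', one_smul]
      abel
    simp only [diffQuot, h1, h2]
    ring

theorem integrable_diffQuot (h : IsBoundedSublinear σ C) {X : Type*} [MeasurableSpace X]
    {μ : Measure X} {P Q : X → EuclideanSpace ℝ (Fin n)} (hP : Measurable P) (hQm : Measurable Q)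
    (hQ : Integrable Q μ) {a : ℝ} (ha : 0 < a) :
    Integrable (fun x => diffQuot σ (P x) (Q x) a) μ := by
  refine (hQ.norm.const_mul C).mono' ?_ (Eventually.of_forall fun x => ?_)
  · have hm₁ : Measurable fun x => σ (P x + a • Q x) :=
      h.continuous.measurable.comp (hP.add (hQm.const_smul a))
    have hm₂ : Measurable fun x => σ (P x) := h.continuous.measurable.comp hP
    exact ((hm₁.sub hm₂).div_const a).aestronglyMeasurable
  · exact h.abs_diffQuot_le _ _ ha

theorem tendsto_integral_diffQuot (h : IsBoundedSublinear σ C)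
    (φ : EuclideanSpace ℝ (Fin n) → ℝ) {w : EuclideanSpace ℝ (Fin n) → ℝ}
    (hw : w ∈ testFunctions U) :
    Tendsto (fun k : ℕ => ∫ x in U, diffQuot σ (gradient φ x) (gradient w x) ((k : ℝ) + 1)⁻¹)
      atTop (𝓝 (energy σ φ U w)) := by
  have hi := testFunctions.integrable_gradient hw
  refine tendsto_integral_of_dominated_convergence (fun x => C * ‖gradient w x‖)
    (fun k => (integrable_diffQuot h (measurable_gradient φ) (measurable_gradient w) hi
      (by positivity)).1) (hi.norm.const_mul C)
    (fun k => Eventually.of_forall fun x => h.abs_diffQuot_le _ _ (by positivity))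
    (Eventually.of_forall fun x => ?_)
  simpa using h.tendsto_diffQuot_seq (gradient φ x) (gradient w x)

theorem exists_lipschitzWith_of_mem_testFunctions {w : EuclideanSpace ℝ (Fin n) → ℝ}
    (hw : w ∈ testFunctions U) : ∃ K, LipschitzWith K w :=
  ContDiff.lipschitzWith_of_hasCompactSupport hw.2.1 hw.1 (by simp)

/-- Lower bounds for the energies of `w₁ - T` and `w₂ + T` meet an upper bound by difference
quotients of `w₁, w₂`, which tend to the almost tight energies as the step tends to `0`. -/
theorem setIntegral_posPart_mul_le (h : IsBoundedSublinear σ C) (hU : IsOpen U)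
    (hD : IsCompact D) (hne : D.Nonempty) (hδ : 0 < δ)
    (hDU : ∀ x, Metric.infDist x D ≤ 2 * δ → x ∈ U)
    (hφ₁ : ∃ K, LipschitzWith K φ₁) (hφ₂ : ∃ K, LipschitzWith K φ₂)
    (hφD : ∀ x ∈ D, φ₁ x = φ₂ x) (hφN : ∀ x, Metric.infDist x D ≤ 2 * δ → x ∉ D → φ₁ x < φ₂ x)
    {z₁ z₂ : EuclideanSpace ℝ (Fin n) → EuclideanSpace ℝ (Fin n)}
    {g₁ g₂ : EuclideanSpace ℝ (Fin n) → ℝ}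
    (hz₁ : HasL2Divergence U z₁ g₁) (hz₂ : HasL2Divergence U z₂ g₂)
    (hs₁ : ∀ᵐ x ∂volume.restrict U, z₁ x ∈ subdifferential σ (gradient φ₁ x))
    (hs₂ : ∀ᵐ x ∂volume.restrict U, z₂ x ∈ subdifferential σ (gradient φ₂ x))
    (hw₁ : w₁ ∈ testFunctions U) (hw₂ : w₂ ∈ testFunctions U) {ε : ℝ}
    (ht₁ : energy σ φ₁ U w₁ ≤ -(∫ x in U, g₁ x * w₁ x) + ε)
    (ht₂ : energy σ φ₂ U w₂ ≤ -(∫ x in U, g₂ x * w₂ x) + ε) :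
    ∫ x in D, max (w₁ x - w₂ x) 0 * (g₁ x - g₂ x) ≤ 2 * ε := by
  have hDsubU : D ⊆ U := fun x hx => hDU x (by rw [Metric.infDist_zero_of_mem hx]; positivity)
  have hφle : ∀ x, Metric.infDist x D ≤ 2 * δ → φ₁ x ≤ φ₂ x := fun x hx => by
    by_cases hxD : x ∈ D
    · exact (hφD x hxD).le
    · exact (hφN x hx hxD).le
  set N := {x | Metric.infDist x D ≤ 2 * δ} with hN
  have hinf : Continuous fun x => Metric.infDist x D := Metric.continuous_infDist_pt D
  have hNc : IsCompact N := by
    refine (hD.cthickening (r := 3 * δ)).of_isClosed_subset (isClosed_le hinf continuous_const) ?_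
    intro x hx
    refine Metric.thickening_subset_cthickening _ _ ?_
    rw [Metric.mem_thickening_iff_infDist_lt hne]
    have hx : Metric.infDist x D ≤ 2 * δ := hx
    linarith
  have hφc : Continuous fun x => φ₂ x - φ₁ x := by
    obtain ⟨_, l₁⟩ := hφ₁
    obtain ⟨_, l₂⟩ := hφ₂
    exact l₂.continuous.sub l₁.continuous
  -- A uniform gap on the compact shell between distances `δ` and `2δ`: once `M * c ≥ B`, the
  -- overlap vanishes there and the cutoff contributes no gradient.
  obtain ⟨c, hc0, hc⟩ : ∃ c > 0, ∀ x, Metric.infDist x D ≤ 2 * δ → δ ≤ Metric.infDist x D →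
      c ≤ φ₂ x - φ₁ x := by
    have hA : IsCompact (N ∩ {x | δ ≤ Metric.infDist x D}) :=
      hNc.inter_right (isClosed_le continuous_const hinf)
    obtain ⟨c, hc0, hc⟩ := hA.exists_forall_le' hφc.continuousOn (a := 0) (by
      rintro x ⟨hx1, hx2⟩
      refine sub_pos.2 (hφN x hx1 fun hxD => ?_)
      have hx2 : δ ≤ Metric.infDist x D := hx2
      rw [Metric.infDist_zero_of_mem hxD] at hx2
      linarith)
    exact ⟨c, hc0, fun x h1 h2 => hc x ⟨h1, h2⟩⟩
  obtain ⟨B₁, hB₁⟩ := hw₁.2.1.exists_bound_of_continuous hw₁.1.continuous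
  obtain ⟨B₂, hB₂⟩ := hw₂.2.1.exists_bound_of_continuous hw₂.1.continuous
  set B := B₁ + B₂ with hBdef
  have hB0 : 0 ≤ B :=
    add_nonneg ((norm_nonneg _).trans (hB₁ 0)) ((norm_nonneg _).trans (hB₂ 0))
  have hB : ∀ x, w₁ x - w₂ x ≤ B := fun x => by
    have h1 := (le_abs_self _).trans (hB₁ x)
    have h2 := (neg_le_abs _).trans (hB₂ x)
    linarith
  -- With this slope the cap is at least `B` within distance `δ` of `D`, hence inactive there.
  set κ := B / δ with hκdef
  have hκ : κ * δ = B := div_mul_cancel₀ _ hδ.ne'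
  have hκ0 : 0 ≤ κ := by positivity
  set T : ℕ → EuclideanSpace ℝ (Fin n) → ℝ := fun k =>
    overlap D δ κ w₁ w₂ φ₁ φ₂ ((k : ℝ) + 1) with hT
  have hk0 : ∀ k : ℕ, (0 : ℝ) < (k : ℝ) + 1 := fun k => by positivity
  have hlarge : ∀ᶠ k : ℕ in atTop, B ≤ ((k : ℝ) + 1) * c := by
    obtain ⟨k₀, hk₀⟩ := exists_nat_gt (B / c)
    filter_upwards [eventually_ge_atTop k₀] with k hk
    have h1 : (k₀ : ℝ) ≤ k := by exact_mod_cast hk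
    rw [div_lt_iff₀ hc0] at hk₀
    nlinarith
  have hTlip : ∀ k, ∃ K, LipschitzWith K (T k) := fun k =>
    exists_lipschitzWith_overlap (exists_lipschitzWith_of_mem_testFunctions hw₁)
      (exists_lipschitzWith_of_mem_testFunctions hw₂) hφ₁ hφ₂
  have hTcont : ∀ k, Continuous (T k) := fun k => (hTlip k).choose_spec.continuous
  have hTzero : ∀ k x, x ∉ N → T k x = 0 := fun k x hx =>
    overlap_eq_zero_of_far (not_le.1 hx).le
  have hTsupp : ∀ k, tsupport (T k) ⊆ N := fun k =>
    closure_minimal (fun x hx => by_contra fun hxN => hx (hTzero k x hxN)) hNc.isClosed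
  have hTc : ∀ k, HasCompactSupport (T k) := fun k =>
    hNc.of_isClosed_subset (isClosed_tsupport _) (hTsupp k)
  have hTm : ∀ k, MemLp (T k) 2 (volume.restrict U) := fun k =>
    ((hTcont k).memLp_of_hasCompactSupport (hTc k)).restrict U
  have hgd : MemLp (fun x => g₁ x - g₂ x) 2 (volume.restrict U) :=
    hz₁.div_memLp.sub hz₂.div_memLp
  have hlow : ∀ {ψ : EuclideanSpace ℝ (Fin n) → ℝ} {z g},
      HasL2Divergence U z g →
      (∀ᵐ x ∂volume.restrict U, z x ∈ subdifferential σ (gradient ψ x)) →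
      ∀ {v : EuclideanSpace ℝ (Fin n) → ℝ}, (∃ K, LipschitzWith K v) → HasCompactSupport v →
      tsupport v ⊆ U → -∫ x in U, g x * v x ≤ energy σ ψ U v := by
    rintro ψ z g hz hs v ⟨K, hK⟩ hvc hvU
    exact neg_integral_le_integral_dirDeriv h hs hz.field_memLp
      (integrable_gradient_of_lipschitz hK hvc).restrict
      (hz.integral_inner_gradient hU hK hvc hvU)
  have hmain : ∀ᶠ k in atTop, ∫ x in U, T k x * (g₁ x - g₂ x) ≤
      ((∫ x in U, diffQuot σ (gradient φ₁ x) (gradient w₁ x) ((k : ℝ) + 1)⁻¹) +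
        ∫ x in U, diffQuot σ (gradient φ₂ x) (gradient w₂ x) ((k : ℝ) + 1)⁻¹) +
      ((∫ x in U, g₁ x * w₁ x) + ∫ x in U, g₂ x * w₂ x) := by
    filter_upwards [hlarge] with k hk
    obtain ⟨K₁, l₁⟩ := exists_lipschitzWith_of_mem_testFunctions hw₁
    obtain ⟨K₂, l₂⟩ := exists_lipschitzWith_of_mem_testFunctions hw₂
    obtain ⟨KT, lT⟩ := hTlip k
    have hNU : N ⊆ U := fun x hx => hDU x hx
    have hv₁l : LipschitzWith (K₁ + KT) (w₁ - T k) := l₁.sub lT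
    have hv₂l : LipschitzWith (K₂ + KT) (w₂ + T k) := l₂.add lT
    have hv₁c : HasCompactSupport (w₁ - T k) := hw₁.2.1.sub (hTc k)
    have hv₂c : HasCompactSupport (w₂ + T k) := hw₂.2.1.add (hTc k)
    have a₁ := hlow hz₁ hs₁ ⟨_, hv₁l⟩ hv₁c
      ((tsupport_sub _ _).trans (union_subset hw₁.2.2 ((hTsupp k).trans hNU)))
    have a₂ := hlow hz₂ hs₂ ⟨_, hv₂l⟩ hv₂c
      ((tsupport_add _ _).trans (union_subset hw₂.2.2 ((hTsupp k).trans hNU)))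
    have i₁ := integrable_dirDeriv h (measurable_gradient φ₁)
      (integrable_gradient_of_lipschitz hv₁l hv₁c).restrict (μ := volume.restrict U)
    have i₂ := integrable_dirDeriv h (measurable_gradient φ₂)
      (integrable_gradient_of_lipschitz hv₂l hv₂c).restrict (μ := volume.restrict U)
    have j₁ := integrable_diffQuot h (measurable_gradient φ₁) (measurable_gradient w₁)
      (testFunctions.integrable_gradient hw₁) (inv_pos.2 (hk0 k))
    have j₂ := integrable_diffQuot h (measurable_gradient φ₂) (measurable_gradient w₂)
      (testFunctions.integrable_gradient hw₂) (inv_pos.2 (hk0 k))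
    have hswap : energy σ φ₁ U (w₁ - T k) + energy σ φ₂ U (w₂ + T k) ≤
        (∫ x in U, diffQuot σ (gradient φ₁ x) (gradient w₁ x) ((k : ℝ) + 1)⁻¹) +
        ∫ x in U, diffQuot σ (gradient φ₂ x) (gradient w₂ x) ((k : ℝ) + 1)⁻¹ := by
      unfold energy
      rw [← integral_add i₁ i₂, ← integral_add j₁ j₂]
      refine integral_mono_ae (i₁.add i₂) (j₁.add j₂) (ae_restrict_of_ae ?_)
      obtain ⟨_, m₁⟩ := hφ₁
      obtain ⟨_, m₂⟩ := hφ₂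
      filter_upwards [lT.ae_differentiableAt, gradient_eq_zero_of_zero_ae lT,
        m₁.ae_differentiableAt, m₂.ae_differentiableAt] with x hxT hx0 e₁ e₂
      have d₁ := testFunctions.differentiable hw₁ x
      have d₂ := testFunctions.differentiable hw₂ x
      rw [gradient_sub' d₁ hxT, gradient_add' d₂ hxT]
      refine dirDeriv_swap_le h (hk0 k) ?_
      rcases (overlap_nonneg hκ0 x : 0 ≤ T k x).eq_or_lt with h0 | h0
      · exact Or.inl (hx0 h0.symm)
      · exact Or.inr (gradient_overlap hδ hκ hκ0 hB hB0 (hk0 k).le hk hφle hc (hTcont k)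
          d₁ d₂ e₁ e₂ h0)
    have ig : ∀ {g v : EuclideanSpace ℝ (Fin n) → ℝ}, MemLp g 2 (volume.restrict U) →
        MemLp v 2 (volume.restrict U) → Integrable (fun x => g x * v x) (volume.restrict U) :=
      fun hg hv => hg.integrable_mul hv
    have b₁ : ∫ x in U, g₁ x * (w₁ - T k) x =
        (∫ x in U, g₁ x * w₁ x) - ∫ x in U, g₁ x * T k x := by
      rw [← integral_sub (ig hz₁.div_memLp (testFunctions.memLp hw₁)) (ig hz₁.div_memLp (hTm k))]
      simp only [Pi.sub_apply, mul_sub]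
    have b₂ : ∫ x in U, g₂ x * (w₂ + T k) x =
        (∫ x in U, g₂ x * w₂ x) + ∫ x in U, g₂ x * T k x := by
      rw [← integral_add (ig hz₂.div_memLp (testFunctions.memLp hw₂)) (ig hz₂.div_memLp (hTm k))]
      simp only [Pi.add_apply, mul_add]
    have b₃ : ∫ x in U, T k x * (g₁ x - g₂ x) =
        (∫ x in U, g₁ x * T k x) - ∫ x in U, g₂ x * T k x := by
      rw [← integral_sub (ig hz₁.div_memLp (hTm k)) (ig hz₂.div_memLp (hTm k))]
      refine integral_congr_ae (Eventually.of_forall fun x => ?_)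
      ring
    rw [b₁] at a₁
    rw [b₂] at a₂
    rw [b₃]
    linarith
  have hlimR := ((tendsto_integral_diffQuot h φ₁ hw₁).add
    (tendsto_integral_diffQuot h φ₂ hw₂)).add_const
      ((∫ x in U, g₁ x * w₁ x) + ∫ x in U, g₂ x * w₂ x)
  have hgN : IntegrableOn (fun x => g₁ x - g₂ x) N (volume.restrict U) := by
    have : IsFiniteMeasure ((volume.restrict U).restrict N) :=
      ⟨by
        rw [Measure.restrict_apply_univ]
        exact (Measure.restrict_apply_le _ _).trans_lt hNc.measure_lt_top⟩
    exact (hgd.restrict N).integrable one_le_two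
  -- On `D` the penalty `φ₂ - φ₁` is zero and the overlap is `(w₁ - w₂)⁺` for every `k`; at each
  -- other point it is eventually zero.
  have hlimL : Tendsto (fun k => ∫ x in U, T k x * (g₁ x - g₂ x)) atTop
      (𝓝 (∫ x in U, D.indicator (fun x => max (w₁ x - w₂ x) 0 * (g₁ x - g₂ x)) x)) := by
    refine tendsto_integral_of_dominated_convergence
      (N.indicator fun x => B * ‖g₁ x - g₂ x‖) (fun k => (hTm k).1.mul hgd.1)
      ((integrable_indicator_iff hNc.measurableSet).2 (hgN.norm.const_mul B))
      (fun k => Eventually.of_forall fun x => ?_) (Eventually.of_forall fun x => ?_)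
    · by_cases hxN : x ∈ N
      · rw [indicator_of_mem hxN, norm_mul]
        gcongr
        rw [Real.norm_of_nonneg (overlap_nonneg hκ0 x)]
        exact overlap_le hB hB0 (hk0 k).le hφle x
      · rw [indicator_of_notMem hxN, hTzero k x hxN, zero_mul, norm_zero]
    · by_cases hxD : x ∈ D
      · rw [indicator_of_mem hxD]
        refine tendsto_const_nhds.congr fun k => ?_
        have h1 : T k x = max (w₁ x - w₂ x - ((k : ℝ) + 1) * (φ₂ x - φ₁ x)) 0 :=
          overlap_eq_of_near hδ hκ hκ0 hB hB0 (hk0 k).le hφle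
            (by rw [Metric.infDist_zero_of_mem hxD]; exact hδ.le)
        rw [h1, hφD x hxD, sub_self, mul_zero, sub_zero]
      · rw [indicator_of_notMem hxD]
        refine tendsto_const_nhds.congr' ?_
        by_cases hxN : x ∈ N
        · have hpos : 0 < φ₂ x - φ₁ x := sub_pos.2 (hφN x hxN hxD)
          obtain ⟨k₀, hk₀⟩ := exists_nat_gt (B / (φ₂ x - φ₁ x))
          filter_upwards [eventually_ge_atTop k₀] with k hk
          have h1 : (k₀ : ℝ) ≤ k := by exact_mod_cast hk
          rw [div_lt_iff₀ hpos] at hk₀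
          have h2 : T k x = 0 := overlap_eq_zero_of_le hB (hk0 k).le
            (by nlinarith : B ≤ ((k : ℝ) + 1) * (φ₂ x - φ₁ x)) hκ0 le_rfl
          rw [h2, zero_mul]
        · filter_upwards with k
          rw [hTzero k x hxN, zero_mul]
  have hfin := le_of_tendsto_of_tendsto hlimL hlimR hmain
  rw [integral_indicator hD.measurableSet, Measure.restrict_restrict hD.measurableSet,
    inter_eq_left.2 hDsubU] at hfin
  linarith

end Swap

/-! ### Passage to the limit and comparison of the optimal divergences. -/

section Comparison

variable {n : ℕ} {U : Set (EuclideanSpace ℝ (Fin n))} {σ : EuclideanSpace ℝ (Fin n) → ℝ} {C : ℝ}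

theorem ae_nonpos_of_setIntegral_posPart_approx {α : Type*} [MeasurableSpace α] {μ : Measure α}
    {D : Set α} {d : α → ℝ} (hd : MemLp d 2 μ)
    (happ : ∀ ε > 0, ∃ w : α → ℝ, MemLp w 2 μ ∧ ∫ x, (w x - d x) ^ 2 ∂μ ≤ ε ^ 2 ∧
      ∫ x in D, max (w x) 0 * d x ∂μ ≤ ε) : ∀ᵐ x ∂μ.restrict D, d x ≤ 0 := by
  have hmax : ∀ {w : α → ℝ}, MemLp w 2 μ → MemLp (fun x => max (w x) 0) 2 μ := fun hw =>
    hw.pos_part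
  have hsq : Integrable (fun x => d x ^ 2) μ := hd.integrable_sq
  have hi : Integrable (fun x => max (d x) 0 * d x) (μ.restrict D) :=
    ((hmax hd).integrable_mul hd).restrict
  set I := ∫ x, d x ^ 2 ∂μ with hI
  have hI0 : 0 ≤ I := integral_nonneg fun x => sq_nonneg _
  have hle : ∫ x in D, max (d x) 0 * d x ∂μ ≤ 0 := by
    have key : ∀ ε : ℝ, 0 < ε → ∫ x in D, max (d x) 0 * d x ∂μ ≤ ε * (2 + I) := by
      intro ε hε
      obtain ⟨w, hw, h1, h2⟩ := happ ε hε
      have hr : Integrable (fun x => (w x - d x) ^ 2) μ := (hw.sub hd).integrable_sq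
      -- Young's inequality with weight `ε`: as `∫ (w - d)² ≤ ε²`, the remainder integrates to at
      -- most `ε (1 + I)`.
      have hpt : ∀ x, max (d x) 0 * d x ≤
          max (w x) 0 * d x + (ε⁻¹ * (w x - d x) ^ 2 + ε * d x ^ 2) := by
        intro x
        have a1 : |max (d x) 0 - max (w x) 0| ≤ |w x - d x| := by
          rw [abs_sub_comm (w x)]
          exact abs_max_sub_max_le_abs _ _ _
        have a2 : (max (d x) 0 - max (w x) 0) * d x ≤ |w x - d x| * |d x| :=
          (le_abs_self _).trans (by rw [abs_mul]; gcongr)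
        have a3 : |w x - d x| * |d x| ≤ ε⁻¹ * (w x - d x) ^ 2 + ε * d x ^ 2 := by
          rw [← sq_abs (w x - d x), ← sq_abs (d x)]
          have e1 := mul_nonneg (inv_pos.2 hε).le (sq_nonneg (|w x - d x| - ε * |d x|))
          have e2 : ε⁻¹ * (|w x - d x| - ε * |d x|) ^ 2 =
              ε⁻¹ * |w x - d x| ^ 2 + ε * |d x| ^ 2 - 2 * (|w x - d x| * |d x|) := by
            field_simp
            ring
          have e3 := mul_nonneg (abs_nonneg (w x - d x)) (abs_nonneg (d x))
          linarith
        linarith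
      have hR : Integrable (fun x => ε⁻¹ * (w x - d x) ^ 2 + ε * d x ^ 2) μ :=
        (hr.const_mul _).add (hsq.const_mul _)
      have hwd : Integrable (fun x => max (w x) 0 * d x) (μ.restrict D) :=
        ((hmax hw).integrable_mul hd).restrict
      calc ∫ x in D, max (d x) 0 * d x ∂μ
          ≤ ∫ x in D, (max (w x) 0 * d x + (ε⁻¹ * (w x - d x) ^ 2 + ε * d x ^ 2)) ∂μ :=
            integral_mono hi (hwd.add hR.restrict) hpt
        _ = (∫ x in D, max (w x) 0 * d x ∂μ) +
            ∫ x in D, (ε⁻¹ * (w x - d x) ^ 2 + ε * d x ^ 2) ∂μ := integral_add hwd hR.restrict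
        _ ≤ ε + ∫ x, (ε⁻¹ * (w x - d x) ^ 2 + ε * d x ^ 2) ∂μ := by
            refine add_le_add h2 (setIntegral_le_integral hR (Eventually.of_forall fun x => ?_))
            simp only [Pi.zero_apply]
            positivity
        _ = ε + (ε⁻¹ * (∫ x, (w x - d x) ^ 2 ∂μ) + ε * I) := by
            rw [integral_add (hr.const_mul _) (hsq.const_mul _), integral_const_mul,
              integral_const_mul]
        _ ≤ ε + (ε⁻¹ * ε ^ 2 + ε * I) := by gcongr
        _ = ε * (2 + I) := by field_simp; ring
    refine le_of_forall_pos_le_add fun η hη => ?_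
    have := key (η / (2 + I)) (by positivity)
    rw [div_mul_cancel₀ _ (by positivity)] at this
    linarith
  have hnn : ∀ x, 0 ≤ max (d x) 0 * d x := fun x => by
    rcases le_total (d x) 0 with h | h
    · rw [max_eq_right h, zero_mul]
    · exact mul_nonneg (le_max_right _ _) h
  have h0 := (integral_eq_zero_iff_of_nonneg hnn hi).1
    (le_antisymm hle (integral_nonneg hnn))
  filter_upwards [h0] with x hx
  by_contra h
  push Not at h
  have hx : max (d x) 0 * d x = 0 := hx
  rw [max_eq_left h.le] at hx
  exact (mul_pos h h).ne' hx

/-- Both the energy and the Cahn–Hoffman condition see `ψ` only through `dirDeriv` at its gradient,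
which a relevelling preserves almost everywhere. -/
theorem energy_eq_and_subdifferential_of_isRelevelling (h : IsBoundedSublinear σ C) (hU : IsOpen U)
    {ψ ψ' φ : EuclideanSpace ℝ (Fin n) → ℝ} (heq : EqOn ψ ψ' U) (hφ : IsRelevelling ψ' φ) :
    (∀ w, energy σ φ U w = energy σ ψ U w) ∧
    ∀ z : EuclideanSpace ℝ (Fin n) → EuclideanSpace ℝ (Fin n),
      (∀ᵐ x ∂volume.restrict U, z x ∈ subdifferential σ (gradient ψ x)) →
      ∀ᵐ x ∂volume.restrict U, z x ∈ subdifferential σ (gradient φ x) := by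
  have hd : ∀ᵐ x ∂volume.restrict U,
      ∀ q, dirDeriv σ (gradient φ x) q = dirDeriv σ (gradient ψ x) q := by
    filter_upwards [ae_restrict_of_ae (hφ.dirDeriv_eq h), ae_restrict_mem hU.measurableSet]
      with x hx hxU q
    rw [hx q, (heq.eventuallyEq_of_mem (hU.mem_nhds hxU)).gradient_eq]
  refine ⟨fun w => integral_congr_ae ?_, fun z hz => ?_⟩
  · filter_upwards [hd] with x hx using hx _
  · filter_upwards [hd, hz] with x hx hzx
    rw [mem_subdifferential_iff h] at hzx ⊢
    intro q
    rw [hx q]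
    exact hzx q

theorem ae_le_of_tight (h : IsBoundedSublinear σ C) (hU : IsOpen U)
    {ψ₁ ψ₂ : EuclideanSpace ℝ (Fin n) → ℝ}
    (hψ₁ : ∃ K, LipschitzOnWith K ψ₁ U) (hψ₂ : ∃ K, LipschitzOnWith K ψ₂ U)
    (hZ : IsCompact (zeroSet U ψ₁ ∩ zeroSet U ψ₂))
    {f₁ f₂ : EuclideanSpace ℝ (Fin n) → ℝ}
    (hf₁ : MemLp f₁ 2 (volume.restrict U)) (hf₂ : MemLp f₂ 2 (volume.restrict U))
    (hsign : ∀ x ∈ U, Real.sign (ψ₁ x) ≤ Real.sign (ψ₂ x))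
    (hf : ∀ᵐ x ∂(volume.restrict U), f₂ x ≤ f₁ x)
    {z₁ z₂ : EuclideanSpace ℝ (Fin n) → EuclideanSpace ℝ (Fin n)}
    {g₁ g₂ : EuclideanSpace ℝ (Fin n) → ℝ}
    (hz₁ : HasL2Divergence U z₁ g₁) (hz₂ : HasL2Divergence U z₂ g₂)
    (hs₁ : ∀ᵐ x ∂volume.restrict U, z₁ x ∈ subdifferential σ (gradient ψ₁ x))
    (hs₂ : ∀ᵐ x ∂volume.restrict U, z₂ x ∈ subdifferential σ (gradient ψ₂ x))
    (ht₁ : ∀ ε > 0, ∃ w ∈ testFunctions U, ∫ x in U, (w x - (g₁ x - f₁ x)) ^ 2 ≤ ε ^ 2 ∧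
      energy σ ψ₁ U w ≤ -(∫ x in U, g₁ x * w x) + ε)
    (ht₂ : ∀ ε > 0, ∃ w ∈ testFunctions U, ∫ x in U, (w x - (g₂ x - f₂ x)) ^ 2 ≤ ε ^ 2 ∧
      energy σ ψ₂ U w ≤ -(∫ x in U, g₂ x * w x) + ε) :
    ∀ᵐ x ∂volume.restrict (zeroSet U ψ₁ ∩ zeroSet U ψ₂), g₁ x - f₁ x ≤ g₂ x - f₂ x := by
  set D := zeroSet U ψ₁ ∩ zeroSet U ψ₂ with hDdef
  have hDU : D ⊆ U := fun x hx => hx.1.1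
  rcases D.eq_empty_or_nonempty with hemp | hne
  · rw [hemp]; simp
  obtain ⟨K₁, hK₁⟩ := hψ₁
  obtain ⟨K₂, hK₂⟩ := hψ₂
  -- Relevelling is done for functions Lipschitz on the whole space; on the open set `U` the
  -- extension has the same gradient as `ψ₁`.
  obtain ⟨χ₁, hχ₁, he₁⟩ := hK₁.extend_real
  obtain ⟨χ₂, hχ₂, he₂⟩ := hK₂.extend_real
  obtain ⟨r, hr, hrU⟩ := hZ.exists_cthickening_subset_open hU hDU
  have hNc : IsCompact (Metric.cthickening r D) := hZ.cthickening
  obtain ⟨φ₁, φ₂, hr₁, hr₂, hφ0, hφlt⟩ := exists_relevellings hNc hχ₁ hχ₂ (fun x hx => by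
    rw [← he₁ (hrU hx), ← he₂ (hrU hx)]
    exact hsign x (hrU hx))
  have hnear : ∀ x, Metric.infDist x D ≤ 2 * (r / 4) → x ∈ Metric.cthickening r D :=
    fun x hx => Metric.thickening_subset_cthickening _ _
      ((Metric.mem_thickening_iff_infDist_lt hne).2 (by linarith))
  obtain ⟨hE₁, hS₁⟩ := energy_eq_and_subdifferential_of_isRelevelling h hU he₁ hr₁
  obtain ⟨hE₂, hS₂⟩ := energy_eq_and_subdifferential_of_isRelevelling h hU he₂ hr₂
  have hg₁ : MemLp (fun x => g₁ x - f₁ x) 2 (volume.restrict U) := hz₁.div_memLp.sub hf₁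
  have hg₂ : MemLp (fun x => g₂ x - f₂ x) 2 (volume.restrict U) := hz₂.div_memLp.sub hf₂
  have hDr : (volume.restrict U).restrict D = volume.restrict D := by
    rw [Measure.restrict_restrict hZ.measurableSet, inter_eq_left.2 hDU]
  have hfin := ae_nonpos_of_setIntegral_posPart_approx (D := D) (hg₁.sub hg₂) (fun ε hε => by
    -- Half of `ε` suits both bounds: `(a - b)² ≤ 2a² + 2b²` gives `ε²`, and the swap gives `2 * (ε
    -- / 2)`.
    obtain ⟨w₁, hw₁, a₁, b₁⟩ := ht₁ (ε / 2) (by positivity)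
    obtain ⟨w₂, hw₂, a₂, b₂⟩ := ht₂ (ε / 2) (by positivity)
    have m₁ := testFunctions.memLp hw₁
    have m₂ := testFunctions.memLp hw₂
    refine ⟨fun x => w₁ x - w₂ x, m₁.sub m₂, ?_, ?_⟩
    · have i₁ : Integrable (fun x => (w₁ x - (g₁ x - f₁ x)) ^ 2) (volume.restrict U) :=
        (m₁.sub hg₁).integrable_sq
      have i₂ : Integrable (fun x => (w₂ x - (g₂ x - f₂ x)) ^ 2) (volume.restrict U) :=
        (m₂.sub hg₂).integrable_sq
      calc _ ≤ ∫ x in U, (2 * (w₁ x - (g₁ x - f₁ x)) ^ 2 + 2 * (w₂ x - (g₂ x - f₂ x)) ^ 2) := by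
            refine integral_mono ((m₁.sub m₂).sub (hg₁.sub hg₂)).integrable_sq
              ((i₁.const_mul 2).add (i₂.const_mul 2)) fun x => ?_
            simp only [Pi.sub_apply]
            nlinarith [sq_nonneg ((w₁ x - (g₁ x - f₁ x)) + (w₂ x - (g₂ x - f₂ x)))]
        _ = 2 * (∫ x in U, (w₁ x - (g₁ x - f₁ x)) ^ 2) +
            2 * ∫ x in U, (w₂ x - (g₂ x - f₂ x)) ^ 2 := by
            rw [integral_add (i₁.const_mul 2) (i₂.const_mul 2), integral_const_mul,
              integral_const_mul]
        _ ≤ ε ^ 2 := by nlinarith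
    -- With `δ = r / 4` the swap region, at distance up to `2δ = r / 2`, lies inside the thickening
    -- where the relevellings are ordered.
    · have hle := setIntegral_posPart_mul_le h hU hZ hne (δ := r / 4) (by positivity)
        (fun x hx => hrU (hnear x hx)) hr₁.lipschitz hr₂.lipschitz
        (fun x hx => hφ0 x (by rw [← he₁ (hDU hx)]; exact hx.1.2)
          (by rw [← he₂ (hDU hx)]; exact hx.2.2))
        (fun x hx hxD => hφlt x (hnear x hx) fun hxx => hxD (by
          have hxU := hrU (hnear x hx)
          exact ⟨⟨hxU, by rw [he₁ hxU]; exact hxx.1⟩, ⟨hxU, by rw [he₂ hxU]; exact hxx.2⟩⟩))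
        hz₁ hz₂ (hS₁ z₁ hs₁) (hS₂ z₂ hs₂) hw₁ hw₂ ((hE₁ w₁).trans_le b₁) ((hE₂ w₂).trans_le b₂)
      rw [hDr]
      refine le_trans ?_ (hle.trans_eq (by ring))
      have mp : MemLp (fun x => max (w₁ x - w₂ x) 0) 2 (volume.restrict U) := (m₁.sub m₂).pos_part
      have j₁ : Integrable (fun x => max (w₁ x - w₂ x) 0 * ((g₁ x - f₁ x) - (g₂ x - f₂ x)))
          (volume.restrict D) := by
        rw [← hDr]; exact (mp.integrable_mul (hg₁.sub hg₂)).restrict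
      have j₂ : Integrable (fun x => max (w₁ x - w₂ x) 0 * (g₁ x - g₂ x)) (volume.restrict D) := by
        rw [← hDr]; exact (mp.integrable_mul (hz₁.div_memLp.sub hz₂.div_memLp)).restrict
      refine integral_mono_ae j₁ j₂ ?_
      filter_upwards [ae_mono (Measure.restrict_mono hDU le_rfl) hf] with x hx
      refine mul_le_mul_of_nonneg_left ?_ (le_max_right _ _)
      simp only [Pi.sub_apply]
      linarith)
  rw [hDr] at hfin
  filter_upwards [hfin] with x hx
  simp only [Pi.sub_apply] at hx
  linarith

end Comparison

end CrystallineCurvature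

theorem mainTheorem4 {n : ℕ} (σ : EuclideanSpace ℝ (Fin n) → ℝ)
    (hσ_convex : ConvexOn ℝ Set.univ σ)
    (hσ_hom : ∀ t : ℝ, 0 < t → ∀ p, σ (t • p) = t * σ p)
    (hσ_pos : ∀ p, p ≠ 0 → 0 < σ p)
    (U : Set (EuclideanSpace ℝ (Fin n))) (hU : IsOpen U)
    (ψ₁ ψ₂ : EuclideanSpace ℝ (Fin n) → ℝ)
    (hψ₁ : ∃ K, LipschitzOnWith K ψ₁ U) (hψ₂ : ∃ K, LipschitzOnWith K ψ₂ U)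
    (hZ₁ : IsCompact (CrystallineCurvature.zeroSet U ψ₁))
    (hZ₂ : IsCompact (CrystallineCurvature.zeroSet U ψ₂))
    (f₁ f₂ : EuclideanSpace ℝ (Fin n) → ℝ)
    (hf₁ : MemLp f₁ 2 (volume.restrict U)) (hf₂ : MemLp f₂ 2 (volume.restrict U))
    (hCH₁ : (CrystallineCurvature.CahnHoffman σ ψ₁ U).Nonempty)
    (hCH₂ : (CrystallineCurvature.CahnHoffman σ ψ₂ U).Nonempty)
    (hsign : ∀ x ∈ U, Real.sign (ψ₁ x) ≤ Real.sign (ψ₂ x))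
    (hf : ∀ᵐ x ∂(volume.restrict U), f₂ x ≤ f₁ x) :
    (∃ Λ₁, CrystallineCurvature.IsLambda σ U f₁ ψ₁ Λ₁) ∧
    (∃ Λ₂, CrystallineCurvature.IsLambda σ U f₂ ψ₂ Λ₂) ∧
    ∀ Λ₁ Λ₂, CrystallineCurvature.IsLambda σ U f₁ ψ₁ Λ₁ →
      CrystallineCurvature.IsLambda σ U f₂ ψ₂ Λ₂ →
      ∀ᵐ x ∂(volume.restrict
        (CrystallineCurvature.zeroSet U ψ₁ ∩ CrystallineCurvature.zeroSet U ψ₂)),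
        Λ₁ x ≤ Λ₂ x := by
  obtain ⟨C, hC⟩ := CrystallineCurvature.exists_isBoundedSublinear hσ_convex hσ_hom
  obtain ⟨z₁, g₁, hm₁, hu₁, ht₁⟩ := CrystallineCurvature.exists_isMinimizer hC hf₁ hCH₁
  obtain ⟨z₂, g₂, hm₂, hu₂, ht₂⟩ := CrystallineCurvature.exists_isMinimizer hC hf₂ hCH₂
  refine ⟨⟨fun x => g₁ x - f₁ x, z₁, g₁, hm₁, Filter.Eventually.of_forall fun x => rfl⟩,
    ⟨fun x => g₂ x - f₂ x, z₂, g₂, hm₂, Filter.Eventually.of_forall fun x => rfl⟩, ?_⟩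
  rintro Λ₁ Λ₂ ⟨y₁, k₁, hn₁, hΛ₁⟩ ⟨y₂, k₂, hn₂, hΛ₂⟩
  have hle := CrystallineCurvature.ae_le_of_tight hC hU hψ₁ hψ₂ (hZ₁.inter hZ₂) hf₁ hf₂ hsign hf
    hm₁.2.1 hm₂.2.1 hm₁.1.2 hm₂.1.2 ht₁ ht₂
  have hsub : CrystallineCurvature.zeroSet U ψ₁ ∩ CrystallineCurvature.zeroSet U ψ₂ ⊆ U :=
    fun x hx => hx.1.1
  -- Uniqueness of the optimal divergence carries the inequality from the constructed minimizers to
  -- arbitrary ones.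
  filter_upwards [hle, ae_mono (Measure.restrict_mono hsub le_rfl) (hu₁ y₁ k₁ hn₁),
    ae_mono (Measure.restrict_mono hsub le_rfl) (hu₂ y₂ k₂ hn₂),
    ae_mono (Measure.restrict_mono Set.inter_subset_left le_rfl) hΛ₁,
    ae_mono (Measure.restrict_mono Set.inter_subset_right le_rfl) hΛ₂] with x h1 h2 h3 h4 h5
  rw [h4, h5, h2, h3]
  exact h1
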